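/- There are absolute constants $C>0$ and $c\in\mathbb N$ such that the following holds for every finite metric space $(X,d_X)$ with $n$ points and all parameters $\nu\in(0,1/6)$, $\epsilon\in(0,1/2)$ and integers $t\ge 1$. There is an oblivious $\nu$-reliable $(12t+\epsilon)$-spanner $\mathcal D$ of $(X,d_X)$ such that, with $s=n^{1+1/t}\nu^{-2}\epsilon^{-3}$ and $r=\nu^{-2}\epsilon^{-4}$, every graph $H$ in the support of $\mathcal D$ has at most $C\,s\,(\log_2 s)^{c}$ edges (size $\tilde O(n^{1+1/t}\nu^{-2}\epsilon^{-3})$; for $n=0$ this bound is read as $0$) and satisfies $$w(H)\le n^{1/t}\cdot C\,r\,(\log_2 r)^{c}\cdot(\log_2 n)^{c}\cdot w(\mathrm{MST}(X))$$ (lightness $n^{1/t}\cdot\tilde O(\nu^{-2}\epsilon^{-4})\cdot\mathrm{polylog}(n)$; for $n\le 1$ this reads $w(H)=0$). Here $w(H)$ is the sum of the edge weights of $H$, and $w(\mathrm{MST}(X))$ is the minimum weight of a spanning tree of $X$, each edge $\{x,y\}$ being weighted by $d_X(x,y)$. An oblivious $\nu$-reliable $\tau$-spanner of $(X,d_X)$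 is a (discrete) probability distribution $\mathcal D$ over graphs $H$ on the vertex set $X$ with nonnegative edge weights such that every $H$ in the support dominates the metric, i.e. $d_X(x,y)\le d_H(x,y)$ for all $x,y\in X$, where $d_H$ is the (possibly infinite) shortest path distance, and such that for every set $B\subseteq X$ there are sets $B_H^+\supseteq B$, one for each $H$ in the support, with $d_{H[X\setminus B]}(x,y)\le \tau\, d_X(x,y)$ for all $x,y\notin B_H^+$, and $\mathbb E_{H\sim\mathcal D}\,|B_H^+|\le(1+\nu)|B|$. -/

import Mathlib

open scoped NNReal ENNReal

namespace ReliableSpanner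

/-- A simple undirected graph on `X` with nonnegative edge weights (the values of `weight` outside
the edge set play no role). -/
structure WGraph (X : Type*) where
  graph : SimpleGraph X
  weight : Sym2 X → ℝ≥0

namespace WGraph

variable {X : Type*}

/-- Shortest path distance: the infimum over all walks of the total weight of the walk. It is `∞`
between different connected components. -/
noncomputable def dist (H : WGraph X) (x y : X) : ℝ≥0∞ :=
  ⨅ p : H.graph.Walk x y, (((p.edges.map H.weight).sum : ℝ≥0) : ℝ≥0∞)

/-- The induced weighted subgraph `H[s]`. -/
def induce (H : WGraph X) (s : Set X) : WGraph s where
  graph := H.graph.induce s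
  weight := fun e => H.weight (e.map Subtype.val)

open Classical in
/-- The number of edges. -/
noncomputable def size [Fintype X] (H : WGraph X) : ℕ :=
  H.graph.edgeFinset.card

open Classical in
/-- The sum of the weights of all edges. -/
noncomputable def totalWeight [Fintype X] (H : WGraph X) : ℝ≥0 :=
  ∑ e ∈ H.graph.edgeFinset, H.weight e

/-- `H` dominates the metric of `X`: `d_X(x,y) ≤ d_H(x,y)` for all `x, y`. -/
def Dominates [MetricSpace X] (H : WGraph X) : Prop :=
  ∀ x y : X, edist x y ≤ H.dist x y

/-- A graph on a metric space, each edge weighted by the distance of its endpoints. -/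
noncomputable def ofMetric [MetricSpace X] (G : SimpleGraph X) : WGraph X where
  graph := G
  weight := Sym2.lift ⟨fun x y => nndist x y, fun x y => nndist_comm x y⟩

end WGraph

/-- The weight of a minimum spanning tree of a finite metric space. -/
noncomputable def mstWeight (X : Type*) [MetricSpace X] [Fintype X] : ℝ≥0 :=
  sInf {w : ℝ≥0 | ∃ T : SimpleGraph X, T.IsTree ∧ w = (WGraph.ofMetric T).totalWeight}

/-- `D` is an oblivious `ν`-reliable `t`-spanner of the finite metric space `X`: a distribution over
dominating weighted graphs such that every attack set `B` has faulty extensions `Bplus H ⊇ B`, one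
for each `H` in the support, so that `H[X ∖ B]` has stretch at most `t` between points outside
`Bplus H`, and the expected size of `Bplus H` is at most `(1 + ν)|B|`. -/
def IsObliviousReliableSpanner {X : Type*} [MetricSpace X] [Fintype X]
    (ν t : ℝ) (D : PMF (WGraph X)) : Prop :=
  (∀ H ∈ D.support, H.Dominates) ∧
  ∀ B : Finset X, ∃ Bplus : WGraph X → Finset X,
    (∀ H ∈ D.support, B ⊆ Bplus H ∧
      ∀ x y : ((B : Set X)ᶜ : Set X), (x : X) ∉ Bplus H → (y : X) ∉ Bplus H →
        (H.induce (B : Set X)ᶜ).dist x y ≤ ENNReal.ofReal t * edist (x : X) (y : X)) ∧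
    ∑' H : WGraph X, D H * ((Bplus H).card : ℝ≥0∞) ≤ ENNReal.ofReal (1 + ν) * (B.card : ℝ≥0∞)

/-- Every graph in the support has at most `m` edges. -/
def HasSize {X : Type*} [Fintype X] (D : PMF (WGraph X)) (m : ℝ) : Prop :=
  ∀ H ∈ D.support, (H.size : ℝ) ≤ m

/-- Every graph in the support has lightness `w(H) / w(MST(X))` at most `φ`, in the form
`w(H) ≤ φ · w(MST(X))` that makes sense for a one-point space as well. -/
def HasLightness {X : Type*} [MetricSpace X] [Fintype X] (D : PMF (WGraph X)) (φ : ℝ) : Prop :=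
  ∀ H ∈ D.support, (H.totalWeight : ℝ) ≤ φ * (mstWeight X : ℝ)

/-- The bound `C · s · log₂(s)^c` that `Õ(s)` stands for. -/
noncomputable def softO (C : ℝ) (c : ℕ) (s : ℝ) : ℝ :=
  C * s * Real.logb 2 s ^ c

end ReliableSpanner

namespace ReliableSpanner

namespace WGraph

variable {X : Type*}

theorem dist_self (H : WGraph X) (x : X) : H.dist x x = 0 :=
  le_antisymm (iInf_le_of_le SimpleGraph.Walk.nil (by simp)) zero_le

theorem dist_triangle (H : WGraph X) (x y z : X) : H.dist x z ≤ H.dist x y + H.dist y z := by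
  unfold dist
  rw [ENNReal.iInf_add]
  refine le_iInf fun p => ?_
  rw [ENNReal.add_iInf]
  refine le_iInf fun q => iInf_le_of_le (p.append q) ?_
  simp [SimpleGraph.Walk.edges_append]

theorem dist_comm (H : WGraph X) (x y : X) : H.dist x y = H.dist y x := by
  have key : ∀ x y, H.dist x y ≤ H.dist y x := fun x y =>
    le_iInf fun p => iInf_le_of_le p.reverse (by
      simp [SimpleGraph.Walk.edges_reverse, List.map_reverse, List.sum_reverse])
  exact le_antisymm (key x y) (key y x)

theorem dist_le_of_adj (H : WGraph X) {x y : X} (h : H.graph.Adj x y) :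
    H.dist x y ≤ H.weight s(x, y) :=
  iInf_le_of_le h.toWalk (by simp [SimpleGraph.Adj.toWalk])

theorem ofMetric_dominates [MetricSpace X] (G : SimpleGraph X) : (ofMetric G).Dominates := by
  intro x y
  refine le_iInf fun p => ?_
  induction p with
  | nil => simp
  | @cons u v w h p ih =>
    refine (edist_triangle u v w).trans ?_
    simp only [SimpleGraph.Walk.edges_cons, List.map_cons, List.sum_cons, ENNReal.coe_add]
    refine add_le_add ?_ ih
    simp [ofMetric]

theorem dist_induce_ofMetric_le [MetricSpace X] (G : SimpleGraph X) (s : Set X) {x y : s}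
    (h : G.Adj x y ∨ x = y) : ((ofMetric G).induce s).dist x y ≤ edist (x : X) y := by
  rcases h with h | rfl
  · refine (dist_le_of_adj _ (x := x) (y := y) h).trans ?_
    simp [induce, ofMetric]
  · simp [dist_self]

end WGraph

section Tour

variable {X : Type*} [MetricSpace X]

/-- The length of the polygonal path through the points of a list. -/
noncomputable def pathLength : List X → ℝ
  | [] => 0
  | [_] => 0
  | x :: y :: l => nndist x y + pathLength (y :: l)

/-- Inserting a point `v` right after an occurrence of `u` makes a path longer by at most
`2 * dist u v`. -/
theorem exists_insert_after {u : X} (v : X) {l : List X} (hu : u ∈ l) :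
    ∃ l' : List X, l'.head? = l.head? ∧ (∀ x, x ∈ l' ↔ x = v ∨ x ∈ l) ∧
      pathLength l' ≤ pathLength l + 2 * dist u v := by
  induction l with
  | nil => simp at hu
  | cons a l ih =>
    by_cases hau : u = a
    · subst hau
      refine ⟨u :: v :: l, rfl, fun x => by simp; tauto, ?_⟩
      cases l with
      | nil => simp [pathLength]; have := dist_nonneg (x := u) (y := v); linarith
      | cons c l =>
        simp only [pathLength, coe_nndist]
        have := dist_triangle v u c
        rw [dist_comm v u] at this
        linarith
    · have hl : u ∈ l := by simpa [hau] using hu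
      obtain ⟨l', h1, h2, h3⟩ := ih hl
      refine ⟨a :: l', rfl, fun x => by simp [h2]; tauto, ?_⟩
      cases l with
      | nil => simp at hl
      | cons c l =>
        cases l' with
        | nil => simp at h1
        | cons c' l' =>
          simp only [List.head?_cons, Option.some.injEq] at h1
          subst h1
          simp only [pathLength] at h3 ⊢
          linarith

/-- Points of a list at pairwise distance at least `s` are paid for by the length of the path. -/
theorem separated_le_pathLength {s : ℝ} (l : List X) (N : Finset X)
    (hN : ∀ x ∈ N, ∀ y ∈ N, x ≠ y → s ≤ dist x y) (hl : ∀ x ∈ N, x ∈ l)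
    (hne : N.Nonempty) :
    ((N.card : ℝ) - 1) * s ≤ pathLength l ∧
      ∀ a ∈ l.head?, ∃ x ∈ N, ((N.card : ℝ) - 1) * s + dist a x ≤ pathLength l := by
  classical
  induction l generalizing N with
  | nil => obtain ⟨x, hx⟩ := hne; simpa using hl x hx
  | cons a l ih =>
    suffices h : ∃ x ∈ N, ((N.card : ℝ) - 1) * s + dist a x ≤ pathLength (a :: l) by
      refine ⟨?_, fun b hb => ?_⟩
      swap
      · simp only [List.head?_cons, Option.mem_some_iff] at hb
        subst hb
        exact h
      obtain ⟨x, _, hx⟩ := h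
      linarith [dist_nonneg (x := a) (y := x)]
    by_cases haN : a ∈ N
    · refine ⟨a, haN, ?_⟩
      rcases (N.erase a).eq_empty_or_nonempty with he | he
      · have : N = {a} := by
          rw [← Finset.insert_erase haN, he]; rfl
        subst this
        have : 0 ≤ pathLength (a :: l) := by
          clear ih hl he haN hne hN
          induction l generalizing a with
          | nil => simp [pathLength]
          | cons c l ih => simp only [pathLength]; have := ih c; positivity
        simpa using this
      · have hl' : ∀ x ∈ N.erase a, x ∈ l := fun x hx => by
          have := hl x (Finset.mem_of_mem_erase hx)
          simpa [Finset.ne_of_mem_erase hx] using this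
        obtain ⟨-, h2⟩ := ih (N.erase a) (fun x hx y hy => hN x (Finset.mem_of_mem_erase hx) y
          (Finset.mem_of_mem_erase hy)) hl' he
        cases l with
        | nil => obtain ⟨x, hx⟩ := he; simpa using hl' x hx
        | cons c l =>
          obtain ⟨x, hx, h3⟩ := h2 c rfl
          have hc : ((N.erase a).card : ℝ) = N.card - 1 := by
            rw [Finset.card_erase_of_mem haN, Nat.cast_sub (Finset.card_pos.2 hne)]; simp
          rw [hc] at h3
          have h4 := hN a haN x (Finset.mem_of_mem_erase hx) (Finset.ne_of_mem_erase hx).symm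
          have h5 := dist_triangle a c x
          simp only [pathLength, coe_nndist, _root_.dist_self]
          linarith
    · have hl' : ∀ x ∈ N, x ∈ l := fun x hx => by
        have := hl x hx
        have hxa : x ≠ a := fun h => haN (h ▸ hx)
        simpa [hxa] using this
      obtain ⟨-, h2⟩ := ih N hN hl' hne
      cases l with
      | nil => obtain ⟨x, hx⟩ := hne; simpa using hl' x hx
      | cons c l =>
        obtain ⟨x, hx, h3⟩ := h2 c rfl
        refine ⟨x, hx, ?_⟩
        have h5 := dist_triangle a c x
        simp only [pathLength, coe_nndist]
        linarith

end Tour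

section Packing

variable {X : Type*} [MetricSpace X] [Fintype X]

open Classical in
/-- A connected graph has a tour through all vertices of at most twice its weight. -/
theorem exists_tour (G : SimpleGraph X) (hG : G.Connected) :
    ∃ l : List X, (∀ x, x ∈ l) ∧ pathLength l ≤ 2 * (WGraph.ofMetric G).totalWeight := by
  obtain ⟨x₀⟩ := hG.nonempty
  have step : ∀ m : ℕ, m + 1 ≤ Fintype.card X → ∃ (l : List X) (E : Finset (Sym2 X)),
      m + 1 ≤ l.toFinset.card ∧ E ⊆ G.edgeFinset ∧ (∀ e ∈ E, ∀ x ∈ e, x ∈ l) ∧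
      pathLength l ≤ 2 * ((∑ e ∈ E, (WGraph.ofMetric G).weight e : ℝ≥0) : ℝ) := by
    intro m
    induction m with
    | zero =>
      intro _
      exact ⟨[x₀], ∅, by simp, by simp, by simp, by simp [pathLength]⟩
    | succ m ih =>
      intro hm
      obtain ⟨l, E, h1, h2, h3, h4⟩ := ih (by omega)
      by_cases hfull : ∀ x, x ∈ l
      · refine ⟨l, E, ?_, h2, h3, h4⟩
        have : l.toFinset = Finset.univ := by ext; simp [hfull]
        rw [this]; exact hm
      push Not at hfull
      obtain ⟨y, hy⟩ := hfull
      have hne : l.toFinset.Nonempty := Finset.card_pos.1 (by omega)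
      obtain ⟨x, hx⟩ := hne
      obtain ⟨p⟩ := hG.preconnected x y
      obtain ⟨d, _, hd1, hd2⟩ := p.exists_boundary_dart {x | x ∈ l} (by simpa using hx) hy
      obtain ⟨l', _, hl2, hl3⟩ := exists_insert_after d.snd hd1
      have hnE : s(d.fst, d.snd) ∉ E := fun h => hd2 (h3 _ h _ (by simp))
      refine ⟨l', insert s(d.fst, d.snd) E, ?_, ?_, ?_, ?_⟩
      · have : l'.toFinset = insert d.snd l.toFinset := by ext x; simp [hl2]
        rw [this, Finset.card_insert_of_notMem (by simpa using hd2)]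
        omega
      · intro e he
        rcases Finset.mem_insert.1 he with rfl | he
        · simp [d.adj]
        · exact h2 he
      · intro e he x hx
        rw [hl2]
        rcases Finset.mem_insert.1 he with rfl | he
        · rcases Sym2.mem_iff.1 hx with rfl | rfl
          · exact Or.inr hd1
          · exact Or.inl rfl
        · exact Or.inr (h3 e he x hx)
      · rw [Finset.sum_insert hnE]
        have : ((WGraph.ofMetric G).weight s(d.fst, d.snd) : ℝ) = dist d.fst d.snd := by
          simp [WGraph.ofMetric]
        push_cast at h4 ⊢
        rw [this]
        linarith
  have hpos : 0 < Fintype.card X := Fintype.card_pos_iff.2 ⟨x₀⟩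
  obtain ⟨l, E, h1, h2, -, h4⟩ := step (Fintype.card X - 1) (by omega)
  refine ⟨l, fun x => ?_, h4.trans ?_⟩
  · have : l.toFinset = Finset.univ := by
      apply Finset.eq_univ_of_card
      have := Finset.card_le_univ l.toFinset
      omega
    have hx := Finset.mem_univ x
    rw [← this] at hx
    simpa using hx
  · gcongr
    unfold WGraph.totalWeight
    exact Finset.sum_le_sum_of_subset h2

theorem separated_card_le {s : ℝ} (N : Finset X) (hne : N.Nonempty)
    (hN : ∀ x ∈ N, ∀ y ∈ N, x ≠ y → s ≤ dist x y) :
    ((N.card : ℝ) - 1) * s ≤ 2 * mstWeight X := by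
  obtain ⟨x, hx⟩ := hne
  have hT : ∃ T : SimpleGraph X, T ≤ ⊤ ∧ T.IsTree := by
    have : Nonempty X := ⟨x⟩
    exact SimpleGraph.connected_top.exists_isTree_le
  have : (((N.card : ℝ) - 1) * s / 2).toNNReal ≤ mstWeight X := by
    obtain ⟨T, -, hT⟩ := hT
    refine le_csInf ⟨_, T, hT, rfl⟩ ?_
    rintro w ⟨T, hT, rfl⟩
    obtain ⟨l, hl, hlen⟩ := exists_tour T hT.connected
    have := (separated_le_pathLength l N hN (fun x _ => hl x) ⟨x, hx⟩).1
    rw [Real.toNNReal_le_iff_le_coe]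
    linarith
  rw [Real.toNNReal_le_iff_le_coe] at this
  linarith

theorem dist_le_two_mul_mstWeight (x y : X) : dist x y ≤ 2 * mstWeight X := by
  classical
  by_cases hxy : x = y
  · subst hxy; simp
  have := separated_card_le (s := dist x y) {x, y} (by simp) (by
    intro a ha b hb hab
    simp only [Finset.mem_insert, Finset.mem_singleton] at ha hb
    rcases ha with rfl | rfl <;> rcases hb with rfl | rfl
    · exact absurd rfl hab
    · exact le_rfl
    · exact (dist_comm _ _).le
    · exact absurd rfl hab)
  rw [Finset.card_pair hxy] at this
  norm_num at this
  exact this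

open Classical in
/-- A map that moves every point by at most `s` onto an `s`-separated net. -/
theorem exists_net_map {s : ℝ} (hs : 0 < s) :
    ∃ f : X → X, (∀ x, dist x (f x) ≤ s) ∧
      ((Finset.univ.image f).card - 1 : ℝ) * s ≤ 2 * mstWeight X := by
  rcases isEmpty_or_nonempty X with hX | hX
  · refine ⟨id, fun x => hX.elim x, ?_⟩
    have : (Finset.univ.image (id : X → X)).card = 0 := by simp
    rw [this]
    push_cast
    have := (mstWeight X).coe_nonneg
    linarith
  let Sep : Finset (Finset X) :=
    Finset.univ.filter fun N => ∀ x ∈ N, ∀ y ∈ N, x ≠ y → s ≤ dist x y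
  have hemp : (∅ : Finset X) ∈ Sep := by simp [Sep]
  obtain ⟨N, hN, hmax⟩ := Finset.exists_max_image Sep Finset.card ⟨_, hemp⟩
  have hsep : ∀ x ∈ N, ∀ y ∈ N, x ≠ y → s ≤ dist x y := by simpa [Sep] using hN
  have hcov : ∀ x, ∃ y ∈ N, dist x y ≤ s := by
    intro x
    by_contra! hcon
    have hx : x ∉ N := fun h => by
      have := hcon x h
      rw [dist_self] at this
      linarith
    have : insert x N ∈ Sep := by
      simp only [Sep, Finset.mem_filter, Finset.mem_univ, true_and, Finset.mem_insert]
      rintro a (rfl | ha) b (rfl | hb) hab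
      · exact absurd rfl hab
      · exact (hcon b hb).le
      · rw [dist_comm]; exact (hcon a ha).le
      · exact hsep a ha b hb hab
    have := hmax _ this
    rw [Finset.card_insert_of_notMem hx] at this
    omega
  choose f hf1 hf2 using hcov
  refine ⟨f, hf2, separated_card_le _ (by simp) fun x hx y hy => ?_⟩
  simp only [Finset.mem_image, Finset.mem_univ, true_and] at hx hy
  obtain ⟨a, rfl⟩ := hx
  obtain ⟨b, rfl⟩ := hy
  exact hsep _ (hf1 a) _ (hf1 b)

end Packing

section Carving

variable {X : Type*} [MetricSpace X] [Fintype X] {ι : Type*}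

open Classical in
/-- Region growing: there is a ball that contains at least a fraction `p` of the sets that it
meets. -/
theorem exists_ball_of_growth {k : ℕ} (hk : 1 ≤ k) {ρ p : ℝ} (hp : 0 < p)
    (hpk : p ^ k * Fintype.card X ≤ 1) (A : ι → Set X) (hne : ∀ i, (A i).Nonempty)
    (hdiam : ∀ i, ∀ x ∈ A i, ∀ y ∈ A i, dist x y ≤ ρ) (I : Finset ι) (hI : I.Nonempty) :
    ∃ (v : X) (r : ℝ), r ≤ k * ρ ∧ (∃ i ∈ I, A i ⊆ Metric.closedBall v r) ∧
      p * (I.filter fun i => (A i ∩ Metric.closedBall v r).Nonempty).card ≤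
        (I.filter fun i => A i ⊆ Metric.closedBall v r).card := by
  choose c hc using hne
  have hρ : 0 ≤ ρ := by
    obtain ⟨i, _⟩ := hI
    simpa using hdiam i _ (hc i) _ (hc i)
  obtain ⟨v, hv⟩ : ∃ v : X, (I.card : ℝ) ≤ Fintype.card X * (I.filter fun i => c i = v).card := by
    by_contra! hcon
    obtain ⟨i, hi⟩ := hI
    have h1 : ∑ v : X, (Fintype.card X * (I.filter fun i => c i = v).card : ℝ) <
        ∑ _v : X, (I.card : ℝ) :=
      Finset.sum_lt_sum_of_nonempty ⟨c i, Finset.mem_univ _⟩ fun v _ => hcon v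
    rw [← Finset.mul_sum, Finset.sum_const, Finset.card_univ, nsmul_eq_mul] at h1
    have h2 := Finset.card_eq_sum_card_fiberwise (f := c) (s := I) (t := Finset.univ)
      (fun _ _ => by simp)
    have h3 : (I.card : ℝ) = ∑ v : X, ((I.filter fun i => c i = v).card : ℝ) := by
      exact_mod_cast h2
    rw [← h3] at h1
    exact lt_irrefl _ h1
  let w : ℕ → ℕ := fun j => (I.filter fun i => A i ⊆ Metric.closedBall v (j * ρ)).card
  let h : ℕ → ℕ := fun j => (I.filter fun i => (A i ∩ Metric.closedBall v (j * ρ)).Nonempty).card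
  have hhw : ∀ j, h j ≤ w (j + 1) := by
    intro j
    refine Finset.card_le_card fun i hi => ?_
    simp only [Finset.mem_filter] at hi ⊢
    refine ⟨hi.1, fun x hx => ?_⟩
    obtain ⟨y, hy1, hy2⟩ := hi.2
    have h1 := hdiam i x hx y hy1
    have h2 := dist_triangle x y v
    rw [Metric.mem_closedBall] at hy2 ⊢
    push_cast
    linarith
  have hw1 : (I.filter fun i => c i = v).card ≤ w 1 := by
    refine Finset.card_le_card fun i hi => ?_
    simp only [Finset.mem_filter] at hi ⊢
    refine ⟨hi.1, fun x hx => ?_⟩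
    rw [Metric.mem_closedBall, ← hi.2]
    simpa using hdiam i x hx _ (hc i)
  have hw1' : (I.card : ℝ) ≤ Fintype.card X * w 1 :=
    hv.trans (by gcongr)
  have hcard : 0 < I.card := Finset.card_pos.2 hI
  have hwpos : 0 < w 1 := by
    rcases Nat.eq_zero_or_pos (w 1) with h0 | h0
    · rw [h0] at hw1'
      have : (0 : ℝ) < I.card := by exact_mod_cast hcard
      simp only [Nat.cast_zero, mul_zero] at hw1'
      linarith
    · exact h0
  obtain ⟨j, hj1, hjk, hj⟩ : ∃ j : ℕ, 1 ≤ j ∧ j ≤ k ∧ p * h j ≤ w j := by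
    by_contra! hcon
    have key : ∀ j : ℕ, 1 ≤ j → j ≤ k → (w 1 : ℝ) < p ^ j * w (j + 1) := by
      intro j hj
      induction j, hj using Nat.le_induction with
      | base =>
        intro h1k
        have := hcon 1 le_rfl h1k
        have h2 : p * (h 1 : ℝ) ≤ p * w 2 := by gcongr; exact hhw 1
        simpa using this.trans_le h2
      | succ j hj ih =>
        intro hjk
        have h1 := ih (by omega)
        have h2 := hcon (j + 1) (by omega) hjk
        have h3 : p * (h (j + 1) : ℝ) ≤ p * w (j + 2) := by gcongr; exact hhw _
        calc (w 1 : ℝ) < p ^ j * w (j + 1) := h1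
          _ ≤ p ^ j * (p * w (j + 2)) := by gcongr; linarith
          _ = p ^ (j + 1) * w (j + 1 + 1) := by ring_nf
    have h1 := key k hk le_rfl
    have h2 : w (k + 1) ≤ I.card := Finset.card_filter_le _ _
    have h3 : p ^ k * (w (k + 1) : ℝ) ≤ p ^ k * (Fintype.card X * w 1) := by
      gcongr
      exact (Nat.cast_le.2 h2).trans hw1'
    have h4 : p ^ k * (Fintype.card X * (w 1 : ℝ)) ≤ w 1 := by
      rw [← mul_assoc]
      exact mul_le_of_le_one_left (by positivity) hpk
    linarith
  refine ⟨v, j * ρ, by gcongr, ?_, hj⟩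
  obtain ⟨i, hi⟩ := Finset.card_pos.1 hwpos
  simp only [Finset.mem_filter] at hi
  refine ⟨i, hi.1, hi.2.trans (Metric.closedBall_subset_closedBall ?_)⟩
  gcongr

/-- `f` sends `A` into a single cluster, a cluster being a fibre of `f`. -/
def IsConstOn (f : X → X) (A : Set X) : Prop := ∃ v, ∀ x ∈ A, f x = v

open Classical in
/-- A partition into clusters of radius `k * ρ` such that a fraction `p` of the given sets of
diameter at most `ρ` are contained in a cluster. -/
theorem exists_carving {k : ℕ} (hk : 1 ≤ k) {ρ p : ℝ} (hρ : 0 ≤ ρ) (hp : 0 < p)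
    (hpk : p ^ k * Fintype.card X ≤ 1) (A : ι → Set X) (hne : ∀ i, (A i).Nonempty)
    (hdiam : ∀ i, ∀ x ∈ A i, ∀ y ∈ A i, dist x y ≤ ρ) (I : Finset ι) :
    ∃ f : X → X, (∀ x, dist x (f x) ≤ k * ρ) ∧
      p * I.card ≤ (I.filter fun i => IsConstOn f (A i)).card := by
  induction I using Finset.strongInduction with
  | H I ih =>
    rcases I.eq_empty_or_nonempty with rfl | hI
    · exact ⟨id, fun x => by simp; positivity, by simp⟩
    obtain ⟨v, r, hr, ⟨i₀, hi₀, hi₀r⟩, hgrow⟩ :=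
      exists_ball_of_growth hk hp hpk A hne hdiam I hI
    set hit := I.filter fun i => (A i ∩ Metric.closedBall v r).Nonempty with hhit
    set inn := I.filter fun i => A i ⊆ Metric.closedBall v r with hinn
    have hsub : I \ hit ⊂ I := by
      refine Finset.sdiff_ssubset (Finset.filter_subset _ _) ⟨i₀, ?_⟩
      rw [hhit, Finset.mem_filter]
      exact ⟨hi₀, by rw [Set.inter_eq_left.2 hi₀r]; exact hne i₀⟩
    obtain ⟨f, hf1, hf2⟩ := ih _ hsub
    refine ⟨fun x => if x ∈ Metric.closedBall v r then v else f x, fun x => ?_, ?_⟩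
    · beta_reduce
      split_ifs with hx
      · exact (Metric.mem_closedBall.1 hx).trans hr
      · exact hf1 x
    · have hdisj : Disjoint inn ((I \ hit).filter fun i => IsConstOn f (A i)) := by
        rw [Finset.disjoint_left]
        intro i hi hi'
        simp only [hinn, hhit, Finset.mem_filter, Finset.mem_sdiff, not_and] at hi hi'
        refine hi'.1.2 hi.1 ?_
        rw [Set.inter_eq_left.2 hi.2]
        exact hne i
      have hunion : inn ∪ ((I \ hit).filter fun i => IsConstOn f (A i)) ⊆
          I.filter fun i => IsConstOn (fun x => if x ∈ Metric.closedBall v r then v else f x)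
            (A i) := by
        intro i hi
        simp only [hinn, hhit, Finset.mem_union, Finset.mem_filter, Finset.mem_sdiff,
          not_and] at hi ⊢
        rcases hi with hi | hi
        · exact ⟨hi.1, v, fun x hx => if_pos (hi.2 hx)⟩
        · obtain ⟨u, hu⟩ := hi.2
          refine ⟨hi.1.1, u, fun x hx => ?_⟩
          rw [← hu x hx]
          exact if_neg fun hxr => hi.1.2 hi.1.1 ⟨x, hx, hxr⟩
      have h1 := Finset.card_le_card hunion
      rw [Finset.card_union_of_disjoint hdisj] at h1
      have h2 : I.card = hit.card + (I \ hit).card := by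
        rw [add_comm, Finset.card_sdiff_add_card_eq_card (Finset.filter_subset _ _)]
      have h1' : (inn.card : ℝ) + ((I \ hit).filter fun i => IsConstOn f (A i)).card ≤
          (I.filter fun i => IsConstOn (fun x => if x ∈ Metric.closedBall v r then v else f x)
            (A i)).card := by exact_mod_cast h1
      rw [h2]
      push_cast
      linarith

open Classical in
/-- Finitely many partitions into clusters of radius `k * ρ` such that each of the given sets is
contained in a cluster of one of them. -/
theorem exists_partition_cover {k : ℕ} (hk : 1 ≤ k) {ρ p : ℝ} (hρ : 0 ≤ ρ) (hp : 0 < p)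
    (hp1 : p ≤ 1) (hpk : p ^ k * Fintype.card X ≤ 1) (A : ι → Set X) (hne : ∀ i, (A i).Nonempty)
    (hdiam : ∀ i, ∀ x ∈ A i, ∀ y ∈ A i, dist x y ≤ ρ) (I : Finset ι) (P : ℕ)
    (hP : (1 - p) ^ P * I.card < 1) :
    ∃ F : Fin P → X → X, (∀ a x, dist x (F a x) ≤ k * ρ) ∧
      ∀ i ∈ I, ∃ a, IsConstOn (F a) (A i) := by
  induction P generalizing I with
  | zero =>
    have : I = ∅ := by
      rw [← Finset.card_eq_zero]
      have : (I.card : ℝ) < 1 := by simpa using hP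
      exact_mod_cast Nat.lt_one_iff.1 (by exact_mod_cast this)
    exact ⟨fun a => a.elim0, fun a => a.elim0, by simp [this]⟩
  | succ P ih =>
    obtain ⟨f, hf1, hf2⟩ := exists_carving hk hρ hp hpk A hne hdiam I
    obtain ⟨F, hF1, hF2⟩ := ih (I.filter fun i => ¬ IsConstOn f (A i)) (by
      have h1 := Finset.card_filter_add_card_filter_not (s := I) (fun i => IsConstOn f (A i))
      have h2 : ((I.filter fun i => IsConstOn f (A i)).card : ℝ) +
        (I.filter fun i => ¬ IsConstOn f (A i)).card = I.card := by exact_mod_cast h1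
      have h3 : ((I.filter fun i => ¬ IsConstOn f (A i)).card : ℝ) ≤ (1 - p) * I.card := by
        linarith
      have h4 : 0 ≤ (1 - p) ^ P := pow_nonneg (by linarith) _
      calc _ ≤ (1 - p) ^ P * ((1 - p) * I.card) := by gcongr
        _ = (1 - p) ^ (P + 1) * I.card := by ring
        _ < 1 := hP)
    refine ⟨Fin.cons f F, fun a x => ?_, fun i hi => ?_⟩
    · refine Fin.cases ?_ (fun a => ?_) a
      · exact hf1 x
      · exact hF1 a x
    · by_cases h : IsConstOn f (A i)
      · exact ⟨0, h⟩
      · obtain ⟨a, ha⟩ := hF2 i (Finset.mem_filter.2 ⟨hi, h⟩)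
        exact ⟨a.succ, ha⟩

end Carving

section Laminar

variable {X : Type*}

/-- Any two members are disjoint or nested. -/
def IsLaminar (𝓒 : Finset (Finset X)) : Prop :=
  ∀ C ∈ 𝓒, ∀ D ∈ 𝓒, Disjoint C D ∨ C ⊆ D ∨ D ⊆ C

theorem IsLaminar.subset {𝓒 𝓑 : Finset (Finset X)} (h : IsLaminar 𝓒) (hs : 𝓑 ⊆ 𝓒) :
    IsLaminar 𝓑 := fun C hC D hD => h C (hs hC) D (hs hD)

open Classical in
/-- If `B` misses at most a fraction `θ` of each member of a laminar family, then it misses at most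
a fraction `θ` of their union. -/
theorem IsLaminar.card_biUnion_sdiff_le {𝓑 : Finset (Finset X)} (h : IsLaminar 𝓑) {θ : ℝ}
    {B : Finset X} (hB : ∀ C ∈ 𝓑, ((C \ B).card : ℝ) ≤ θ * C.card) :
    (((𝓑.biUnion id) \ B).card : ℝ) ≤ θ * (𝓑.biUnion id).card := by
  induction 𝓑 using Finset.strongInduction with
  | H 𝓑 ih =>
    rcases 𝓑.eq_empty_or_nonempty with rfl | hne
    · simp
    obtain ⟨C, hC, hmax⟩ := Finset.exists_max_image 𝓑 Finset.card hne
    by_cases hC0 : C = ∅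
    · have h0 : 𝓑.biUnion id = ∅ := by
        refine Finset.eq_empty_of_forall_notMem fun x hx => ?_
        obtain ⟨D, hD, hxD⟩ := Finset.mem_biUnion.1 hx
        have := hmax D hD
        rw [hC0, Finset.card_empty, Nat.le_zero, Finset.card_eq_zero] at this
        simp [this] at hxD
      simp [h0]
    set 𝓑' := 𝓑.filter fun D => Disjoint C D with h𝓑'
    have hss : 𝓑' ⊂ 𝓑 := Finset.filter_ssubset.2
      ⟨C, hC, fun h => hC0 (by simpa using disjoint_self.1 h)⟩
    have hU : 𝓑.biUnion id = C ∪ 𝓑'.biUnion id := by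
      ext x
      simp only [Finset.mem_biUnion, id_eq, Finset.mem_union, h𝓑', Finset.mem_filter]
      constructor
      · rintro ⟨D, hD, hx⟩
        rcases h C hC D hD with h1 | h1 | h1
        · exact Or.inr ⟨D, ⟨hD, h1⟩, hx⟩
        · rw [← Finset.eq_of_subset_of_card_le h1 (hmax D hD)] at hx
          exact Or.inl hx
        · exact Or.inl (h1 hx)
      · rintro (hx | ⟨D, hD, hx⟩)
        · exact ⟨C, hC, hx⟩
        · exact ⟨D, hD.1, hx⟩
    have hdis : Disjoint C (𝓑'.biUnion id) := by
      rw [Finset.disjoint_biUnion_right]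
      intro D hD
      exact (Finset.mem_filter.1 hD).2
    have h1 := ih 𝓑' hss (h.subset hss.subset) fun D hD => hB D (hss.subset hD)
    have h2 := hB C hC
    rw [hU, Finset.union_sdiff_distrib, Finset.card_union_of_disjoint hdis,
      Finset.card_union_of_disjoint
        (hdis.mono Finset.sdiff_subset Finset.sdiff_subset)]
    push_cast
    linarith

open Classical in
/-- The points of `S` that `f` identifies with another point of `S` number at most twice the drop
in cardinality from `S` to its image. -/
theorem card_merging_le (S : Finset X) (f : X → X) :
    (S.filter fun u => ∃ u' ∈ S, u' ≠ u ∧ f u' = f u).card + 2 * (S.image f).card ≤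
      2 * S.card := by
  set M := S.filter fun u => ∃ u' ∈ S, u' ≠ u ∧ f u' = f u with hM
  have h1 : S.card = ∑ v ∈ S.image f, (S.filter fun u => f u = v).card :=
    Finset.card_eq_sum_card_image f S
  have h2 : M.card = ∑ v ∈ S.image f, (M.filter fun u => f u = v).card :=
    Finset.card_eq_sum_card_fiberwise fun u hu =>
      Finset.mem_coe.2 (Finset.mem_image_of_mem f (Finset.filter_subset _ _ hu))
  rw [h1, h2, Finset.mul_sum, Finset.card_eq_sum_ones, Finset.mul_sum, ← Finset.sum_add_distrib]
  refine Finset.sum_le_sum fun v hv => ?_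
  obtain ⟨u, hu, rfl⟩ := Finset.mem_image.1 hv
  have hle : (M.filter fun u' => f u' = f u).card ≤ (S.filter fun u' => f u' = f u).card :=
    Finset.card_le_card (Finset.filter_subset_filter _ (Finset.filter_subset _ _))
  have hpos : 0 < (S.filter fun u' => f u' = f u).card :=
    Finset.card_pos.2 ⟨u, Finset.mem_filter.2 ⟨hu, rfl⟩⟩
  by_cases hone : (S.filter fun u' => f u' = f u).card = 1
  · have h0 : (M.filter fun u' => f u' = f u) = ∅ := by
      refine Finset.eq_empty_of_forall_notMem fun w hw => ?_
      simp only [hM, Finset.mem_filter] at hw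
      obtain ⟨⟨hwS, w', hw'S, hne, hw'⟩, hwu⟩ := hw
      exact hne (Finset.card_le_one.1 hone.le w' (Finset.mem_filter.2 ⟨hw'S, hw'.trans hwu⟩) w
        (Finset.mem_filter.2 ⟨hwS, hwu⟩))
    rw [h0, hone]; simp
  · omega

end Laminar

section Chain

variable {X : Type*}

/-- The successive compositions of a sequence of self-maps. The fibres of the `p`-th map are the
clusters of level `p` of a hierarchy of partitions. -/
def chain (f : ℕ → X → X) : ℕ → X → X
  | 0 => id
  | p + 1 => f p ∘ chain f p

theorem chain_eq_of_le {f : ℕ → X → X} {p q : ℕ} (hpq : p ≤ q) {x y : X}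
    (h : chain f p x = chain f p y) : chain f q x = chain f q y := by
  induction q, hpq using Nat.le_induction with
  | base => exact h
  | succ q _ ih => simp only [chain, Function.comp_apply, ih]

variable [Fintype X]

open Classical in
/-- The cluster of level `p` with label `v`. -/
noncomputable def fiber (f : ℕ → X → X) (p : ℕ) (v : X) : Finset X :=
  Finset.univ.filter fun y => chain f p y = v

/-- The cluster of level `p` that contains `x`. -/
noncomputable def cluster (f : ℕ → X → X) (p : ℕ) (x : X) : Finset X :=
  fiber f p (chain f p x)

theorem mem_cluster {f : ℕ → X → X} {p : ℕ} {x y : X} :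
    y ∈ cluster f p x ↔ chain f p y = chain f p x := by
  simp [cluster, fiber]

theorem self_mem_cluster (f : ℕ → X → X) (p : ℕ) (x : X) : x ∈ cluster f p x :=
  mem_cluster.2 rfl

theorem cluster_eq_of_chain_eq {f : ℕ → X → X} {p : ℕ} {x y : X}
    (h : chain f p x = chain f p y) : cluster f p x = cluster f p y := by
  rw [cluster, cluster, h]

theorem cluster_mono (f : ℕ → X → X) {p q : ℕ} (hpq : p ≤ q) (x : X) :
    cluster f p x ⊆ cluster f q x := fun _ hy =>
  mem_cluster.2 (chain_eq_of_le hpq (mem_cluster.1 hy))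

theorem cluster_zero (f : ℕ → X → X) (x : X) : cluster f 0 x = {x} := by
  ext y; simp [mem_cluster, chain]

open Classical in
/-- All clusters of the levels up to `L`. -/
noncomputable def clusters (f : ℕ → X → X) (L : ℕ) : Finset (Finset X) :=
  (Finset.range (L + 1) ×ˢ Finset.univ).image fun q : ℕ × X => cluster f q.1 q.2

theorem mem_clusters {f : ℕ → X → X} {L : ℕ} {C : Finset X} :
    C ∈ clusters f L ↔ ∃ p x, p ≤ L ∧ cluster f p x = C := by
  simp [clusters]

theorem nonempty_of_mem_clusters {f : ℕ → X → X} {L : ℕ} {C : Finset X} (h : C ∈ clusters f L) :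
    C.Nonempty := by
  obtain ⟨p, x, -, rfl⟩ := mem_clusters.1 h
  exact ⟨x, self_mem_cluster f p x⟩

theorem isLaminar_clusters (f : ℕ → X → X) (L : ℕ) : IsLaminar (clusters f L) := by
  intro C hC D hD
  obtain ⟨p, x, -, rfl⟩ := mem_clusters.1 hC
  obtain ⟨q, y, -, rfl⟩ := mem_clusters.1 hD
  by_cases hdis : Disjoint (cluster f p x) (cluster f q y)
  · exact Or.inl hdis
  right
  obtain ⟨z, hzx, hzy⟩ := Finset.not_disjoint_iff.1 hdis
  rw [← cluster_eq_of_chain_eq (mem_cluster.1 hzx), ← cluster_eq_of_chain_eq (mem_cluster.1 hzy)]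
  rcases le_total p q with h | h
  · exact Or.inl (cluster_mono f h z)
  · exact Or.inr (cluster_mono f h z)

theorem IsLaminar.card_le {𝓒 : Finset (Finset X)} (h : IsLaminar 𝓒) (hne : ∀ C ∈ 𝓒, C.Nonempty) :
    𝓒.card ≤ Fintype.card X * Fintype.card X := by
  classical
  rcases isEmpty_or_nonempty X with hX | hX
  · have : 𝓒 = ∅ := Finset.eq_empty_of_forall_notMem fun C hC => by
      obtain ⟨x, -⟩ := hne C hC
      exact hX.elim x
    simp [this]
  choose! e he using hne
  have : (Finset.univ ×ˢ Finset.Icc 1 (Fintype.card X) : Finset (X × ℕ)).card =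
      Fintype.card X * Fintype.card X := by simp
  rw [← this]
  refine Finset.card_le_card_of_injOn (fun C => (e C, C.card)) (fun C hC => ?_) ?_
  · simp only [Finset.coe_product, Finset.coe_univ, Finset.coe_Icc, Set.mem_prod, Set.mem_univ,
      true_and, Set.mem_Icc]
    exact ⟨Finset.card_pos.2 ⟨_, he C hC⟩, Finset.card_le_univ _⟩
  · intro C hC D hD hCD
    simp only [Prod.mk.injEq] at hCD
    rcases h C hC D hD with h1 | h1 | h1
    · exact absurd (hCD.1 ▸ he D hD) (Finset.disjoint_left.1 h1 (he C hC))
    · exact Finset.eq_of_subset_of_card_le h1 hCD.2.ge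
    · exact (Finset.eq_of_subset_of_card_le h1 hCD.2.le).symm

open Classical in
/-- The labels of the clusters of level `p`. -/
noncomputable def labels (f : ℕ → X → X) (p : ℕ) : Finset X :=
  Finset.univ.image (chain f p)

open Classical in
/-- The labels of the clusters of level `p` that are not clusters of level `p + 1`. -/
noncomputable def merging (f : ℕ → X → X) (p : ℕ) : Finset X :=
  (labels f p).filter fun u => ∃ u' ∈ labels f p, u' ≠ u ∧ f p u' = f p u

theorem labels_succ [DecidableEq X] (f : ℕ → X → X) (p : ℕ) :
    labels f (p + 1) = (labels f p).image (f p) := by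
  ext; simp [labels, chain]

theorem card_merging_add_le (f : ℕ → X → X) (p : ℕ) :
    (merging f p).card + 2 * (labels f (p + 1)).card ≤ 2 * (labels f p).card := by
  classical
  rw [labels_succ]
  convert card_merging_le (labels f p) (f p)
  unfold merging
  congr

theorem chain_mem_merging {f : ℕ → X → X} {p : ℕ} {x : X}
    (h : cluster f p x ≠ cluster f (p + 1) x) : chain f p x ∈ merging f p := by
  classical
  obtain ⟨y, hy, hy'⟩ := Finset.exists_of_ssubset
    ((cluster_mono f (Nat.le_succ p) x).ssubset_of_ne h)
  rw [mem_cluster] at hy hy'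
  simp only [merging, labels, Finset.mem_filter, Finset.mem_image, Finset.mem_univ, true_and]
  exact ⟨⟨x, rfl⟩, chain f p y, ⟨y, rfl⟩, hy', hy⟩

theorem sum_card_merging_le (f : ℕ → X → X) (L : ℕ) :
    ∑ p ∈ Finset.range L, (merging f p).card ≤ 2 * Fintype.card X := by
  have key : ∀ L, ∑ p ∈ Finset.range L, (merging f p).card + 2 * (labels f L).card ≤
      2 * Fintype.card X := by
    intro L
    induction L with
    | zero =>
      simp only [Finset.range_zero, Finset.sum_empty, zero_add]
      gcongr
      exact Finset.card_le_univ _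
    | succ L ih =>
      rw [Finset.sum_range_succ]
      have := card_merging_add_le f L
      omega
  have := key L
  omega

end Chain

section Sampling

variable {X : Type*} [Fintype X]

open Classical in
/-- All functions that choose a point of every nonempty set. -/
noncomputable def choiceFunctions (X : Type*) [Fintype X] : Finset (Finset X → X) :=
  Fintype.piFinset fun C => if C.Nonempty then C else Finset.univ

theorem choiceFunctions_nonempty [Nonempty X] : (choiceFunctions X).Nonempty := by
  classical
  rw [choiceFunctions, Fintype.piFinset_nonempty]
  intro C
  split_ifs with h
  · exact h
  · exact Finset.univ_nonempty

theorem mem_of_mem_choiceFunctions {φ : Finset X → X} (h : φ ∈ choiceFunctions X) {C : Finset X}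
    (hC : C.Nonempty) : φ C ∈ C := by
  classical
  have := Fintype.mem_piFinset.1 h C
  rwa [if_pos hC] at this

open Classical in
theorem card_choiceFunctions_filter {C : Finset X} (hC : C.Nonempty) (B : Finset X) :
    ((choiceFunctions X).filter fun φ => φ C ∈ B).card * C.card =
      (C ∩ B).card * (choiceFunctions X).card := by
  let t : Finset X → Finset X := fun C => if C.Nonempty then C else Finset.univ
  have h1 : ((choiceFunctions X).filter fun φ => φ C ∈ B) =
      Fintype.piFinset (Function.update t C (C ∩ B)) := by
    ext φ
    simp only [choiceFunctions, Finset.mem_filter, Fintype.mem_piFinset]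
    constructor
    · rintro ⟨h1, h2⟩ D
      by_cases hD : D = C
      · subst hD
        have := h1 D
        rw [if_pos hC] at this
        simp [this, h2]
      · rw [Function.update_of_ne hD]
        exact h1 D
    · intro h
      have hCm := h C
      rw [Function.update_self, Finset.mem_inter] at hCm
      refine ⟨fun D => ?_, hCm.2⟩
      by_cases hD : D = C
      · subst hD
        rw [if_pos hC]
        exact hCm.1
      · have := h D
        rwa [Function.update_of_ne hD] at this
  have h2 : ∀ D, (Function.update t C (C ∩ B) D).card =
      Function.update (fun D => (t D).card) C (C ∩ B).card D := by
    intro D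
    by_cases hD : D = C
    · subst hD; simp
    · simp [Function.update_of_ne hD]
  have h3 : (choiceFunctions X).card = C.card * ∏ D ∈ Finset.univ \ {C}, (t D).card := by
    rw [choiceFunctions, Fintype.card_piFinset,
      ← Finset.prod_sdiff (Finset.subset_univ {C}), mul_comm]
    simp [hC, t]
  rw [h1, Fintype.card_piFinset, Finset.prod_congr rfl fun D _ => h2 D,
    Finset.prod_update_of_mem (Finset.mem_univ C), h3]
  ring

open Classical in
/-- Families of `l` choice functions. -/
noncomputable def samples (X : Type*) [Fintype X] (l : ℕ) : Finset (Fin l → Finset X → X) :=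
  Fintype.piFinset fun _ => choiceFunctions X

theorem samples_nonempty [Nonempty X] (l : ℕ) : (samples X l).Nonempty := by
  classical
  rw [samples, Fintype.piFinset_nonempty]
  exact fun _ => choiceFunctions_nonempty

theorem mem_of_mem_samples {l : ℕ} {ω : Fin l → Finset X → X} (h : ω ∈ samples X l) (a : Fin l)
    {C : Finset X} (hC : C.Nonempty) : ω a C ∈ C := by
  classical
  exact mem_of_mem_choiceFunctions (Fintype.mem_piFinset.1 h a) hC

open Classical in
/-- All `l` sampled points of a set hit `B` with probability at most `(1 - θ) ^ l` if `B` misses more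
than a fraction `θ` of the set. -/
theorem card_samples_filter_le (l : ℕ) {C : Finset X} (hC : C.Nonempty) {B : Finset X} {θ : ℝ}
    (hB : θ * C.card < ((C \ B).card : ℝ)) :
    (((samples X l).filter fun ω => ∀ a, ω a C ∈ B).card : ℝ) ≤
      (1 - θ) ^ l * (samples X l).card := by
  have h1 : ((samples X l).filter fun ω => ∀ a, ω a C ∈ B) =
      Fintype.piFinset fun _ : Fin l => (choiceFunctions X).filter fun φ => φ C ∈ B := by
    ext ω
    simp only [samples, Finset.mem_filter, Fintype.mem_piFinset]
    exact forall_and.symm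
  have h2 : ((C ∩ B).card : ℝ) + (C \ B).card = C.card := by
    exact_mod_cast Finset.card_inter_add_card_sdiff C B
  have hCpos : (0 : ℝ) < C.card := by exact_mod_cast Finset.card_pos.2 hC
  have h3 : (((choiceFunctions X).filter fun φ => φ C ∈ B).card : ℝ) ≤
      (1 - θ) * (choiceFunctions X).card := by
    have h4 : ((((choiceFunctions X).filter fun φ => φ C ∈ B).card : ℝ)) * C.card =
      (C ∩ B).card * (choiceFunctions X).card := by
        exact_mod_cast card_choiceFunctions_filter hC B
    refine le_of_mul_le_mul_right ?_ hCpos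
    rw [h4]
    have h5 : ((C ∩ B).card : ℝ) ≤ (1 - θ) * C.card := by linarith
    calc ((C ∩ B).card : ℝ) * (choiceFunctions X).card
        ≤ (1 - θ) * C.card * (choiceFunctions X).card := by gcongr
      _ = _ := by ring
  rw [h1, samples, Fintype.card_piFinset, Fintype.card_piFinset, Finset.prod_const,
    Finset.prod_const, Finset.card_univ, Fintype.card_fin]
  push_cast
  rw [← mul_pow]
  gcongr

end Sampling

section Expectation

theorem tsum_map_mul {α β : Type*} (p : PMF α) (g : α → β) (F : β → ℝ≥0∞) :
    ∑' b, (p.map g) b * F b = ∑' a, p a * F (g a) := by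
  classical
  simp only [PMF.map_apply, ← ENNReal.tsum_mul_right]
  rw [ENNReal.tsum_comm]
  refine tsum_congr fun a => ?_
  rw [tsum_eq_single (g a)]
  · simp
  · intro b hb
    simp [hb]

open Classical in
/-- The expectation of a function that is at most `c`, except at the bad points of `S`, where it is
at most `N`. -/
theorem tsum_map_uniform_le {α β : Type*} [Fintype α] (S : Finset α) (hS : S.Nonempty) (g : α → β)
    (F : β → ℕ) (bad : α → Prop) (c N : ℕ) (hF : ∀ a ∈ S, ¬ bad a → F (g a) ≤ c)
    (hN : ∀ a ∈ S, F (g a) ≤ N) (M : ℝ)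
    (hM : c + N * ((S.filter bad).card : ℝ) / S.card ≤ M) :
    ∑' b, ((PMF.uniformOfFinset S hS).map g) b * (F b : ℝ≥0∞) ≤ ENNReal.ofReal M := by
  rw [tsum_map_mul, tsum_fintype]
  have hSpos : (0 : ℝ) < S.card := by exact_mod_cast Finset.card_pos.2 hS
  have h1 : ∀ a, (PMF.uniformOfFinset S hS) a * (F (g a) : ℝ≥0∞) =
      ENNReal.ofReal (if a ∈ S then (F (g a) : ℝ) / S.card else 0) := by
    intro a
    rw [PMF.uniformOfFinset_apply]
    split_ifs with ha
    · rw [ENNReal.ofReal_div_of_pos hSpos, ENNReal.ofReal_natCast, ENNReal.ofReal_natCast,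
        ENNReal.div_eq_inv_mul]
    · simp
  rw [Finset.sum_congr rfl fun a _ => h1 a, ← ENNReal.ofReal_sum_of_nonneg (by
    intro a _; split_ifs <;> positivity)]
  refine ENNReal.ofReal_le_ofReal (le_trans ?_ hM)
  rw [← Finset.sum_filter, Finset.filter_mem_eq_inter, Finset.univ_inter, ← Finset.sum_div,
    div_le_iff₀ hSpos, add_mul, div_mul_cancel₀ _ hSpos.ne']
  calc ∑ a ∈ S, (F (g a) : ℝ) ≤ ∑ a ∈ S, ((c : ℝ) + if bad a then (N : ℝ) else 0) := by
        refine Finset.sum_le_sum fun a ha => ?_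
        split_ifs with hb
        · have : (F (g a) : ℝ) ≤ N := by exact_mod_cast hN a ha
          have : (0 : ℝ) ≤ c := by positivity
          linarith
        · simpa using hF a ha hb
    _ = _ := by
        rw [Finset.sum_add_distrib, ← Finset.sum_filter]
        simp
        ring

end Expectation

section Spanner

variable {X : Type*} [Fintype X] {J : Type*}

/-- In each of the hierarchies `f j`, every sampled point of a cluster is joined to every sampled
point of the parent cluster, unless the two clusters coincide. -/
noncomputable def spannerGraph (f : J → ℕ → X → X) (L : ℕ) {l : ℕ} (ω : Fin l → Finset X → X) :
    SimpleGraph X :=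
  SimpleGraph.fromRel fun u v => ∃ j, ∃ p < L, ∃ x, cluster (f j) p x ≠ cluster (f j) (p + 1) x ∧
    ∃ a a', u = ω a (cluster (f j) p x) ∧ v = ω a' (cluster (f j) (p + 1) x)

open Classical in
/-- `B` together with all clusters all but a fraction `θ` of which is in `B`. -/
noncomputable def faultySet [Fintype J] (f : J → ℕ → X → X) (L : ℕ) (θ : ℝ) (B : Finset X) :
    Finset X :=
  B ∪ Finset.univ.biUnion fun j =>
    ((clusters (f j) L).filter fun C => ((C \ B).card : ℝ) ≤ θ * C.card).biUnion id

theorem subset_faultySet [Fintype J] (f : J → ℕ → X → X) (L : ℕ) (θ : ℝ) (B : Finset X) :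
    B ⊆ faultySet f L θ B := by
  classical
  exact Finset.subset_union_left

open Classical in
theorem lt_card_sdiff_of_notMem_faultySet [Fintype J] {f : J → ℕ → X → X} {L : ℕ} {θ : ℝ}
    {B : Finset X} {x : X} (hx : x ∉ faultySet f L θ B) (j : J) {p : ℕ} (hp : p ≤ L) :
    θ * (cluster (f j) p x).card < ((cluster (f j) p x \ B).card : ℝ) := by
  by_contra! hcon
  refine hx (Finset.mem_union_right _ (Finset.mem_biUnion.2 ⟨j, Finset.mem_univ j,
    Finset.mem_biUnion.2 ⟨cluster (f j) p x, Finset.mem_filter.2 ⟨mem_clusters.2 ⟨p, x, hp, rfl⟩, ?_⟩,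
      self_mem_cluster _ _ _⟩⟩))
  convert hcon

theorem card_faultySet_le [Fintype J] (f : J → ℕ → X → X) (L : ℕ) {θ : ℝ} (h0 : 0 ≤ θ)
    (hθ : θ ≤ 1 / 2) (B : Finset X) :
    ((faultySet f L θ B).card : ℝ) ≤ (1 + 2 * θ * Fintype.card J) * B.card := by
  classical
  let U : J → Finset X := fun j =>
    ((clusters (f j) L).filter fun C => ((C \ B).card : ℝ) ≤ θ * C.card).biUnion id
  have hU : ∀ j, ((U j \ B).card : ℝ) ≤ 2 * θ * B.card := by
    intro j
    have h1 : ((U j \ B).card : ℝ) ≤ θ * (U j).card :=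
      ((isLaminar_clusters (f j) L).subset (Finset.filter_subset _ _)).card_biUnion_sdiff_le
        fun C hC => (Finset.mem_filter.1 hC).2
    have h2 : (U j).card ≤ B.card + (U j \ B).card := by
      rw [← Finset.card_inter_add_card_sdiff (U j) B]
      gcongr
      exact Finset.inter_subset_right
    have h3 : ((U j).card : ℝ) ≤ B.card + (U j \ B).card := by exact_mod_cast h2
    have h4 : θ * ((U j).card : ℝ) ≤ θ * (B.card + (U j \ B).card) := by gcongr
    have h5 : θ * ((U j \ B).card : ℝ) ≤ 1 / 2 * (U j \ B).card := by gcongr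
    linarith
  have h1 : faultySet f L θ B = B ∪ Finset.univ.biUnion fun j => U j \ B := by
    ext x
    simp only [faultySet, Finset.mem_union, Finset.mem_biUnion, Finset.mem_sdiff, U]
    by_cases hx : x ∈ B
    · simp [hx]
    · simp only [hx, false_or, not_false_eq_true, and_true]
  rw [h1]
  have h2 : ((B ∪ Finset.univ.biUnion fun j => U j \ B).card : ℝ) ≤
      B.card + ∑ j, ((U j \ B).card : ℝ) := by
    exact_mod_cast (Finset.card_union_le _ _).trans (by gcongr; exact Finset.card_biUnion_le)
  have h3 : ∑ j : J, ((U j \ B).card : ℝ) ≤ ∑ _j : J, 2 * θ * B.card :=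
    Finset.sum_le_sum fun j _ => hU j
  rw [Finset.sum_const, Finset.card_univ, nsmul_eq_mul] at h3
  linarith

theorem sum_biUnion_le {ι β : Type*} [DecidableEq β] (I : Finset ι) (T : ι → Finset β)
    (w : β → ℝ≥0) : ∑ e ∈ I.biUnion T, w e ≤ ∑ i ∈ I, ∑ e ∈ T i, w e := by
  classical
  induction I using Finset.induction_on with
  | empty => simp
  | insert i I hi ih =>
    rw [Finset.biUnion_insert, Finset.sum_insert hi]
    refine le_trans ?_ (add_le_add_right ih _)
    rw [← Finset.sum_union_inter]
    exact le_self_add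

theorem sum_image_le_sum {ι β : Type*} [DecidableEq β] (I : Finset ι) (h : ι → β)
    (w : β → ℝ≥0) : ∑ e ∈ I.image h, w e ≤ ∑ i ∈ I, w (h i) := by
  have := sum_biUnion_le I (fun i => {h i}) w
  rw [Finset.biUnion_singleton] at this
  simpa using this

open Classical in
/-- A bound for sums over all edges of the spanner. -/
theorem sum_edgeFinset_le [Fintype J] (f : J → ℕ → X → X) (L : ℕ) {l : ℕ}
    {ω : Fin l → Finset X → X} (w : Sym2 X → ℝ≥0) (c : J → ℕ → ℝ≥0)
    (hc : ∀ j p x a a', w s(ω a (cluster (f j) p x), ω a' (cluster (f j) (p + 1) x)) ≤ c j p) :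
    ∑ e ∈ (spannerGraph f L ω).edgeFinset, w e ≤
      ∑ j, ∑ p ∈ Finset.range L, ((merging (f j) p).card * l ^ 2 : ℕ) * c j p := by
  let T : J → ℕ → X → Finset (Sym2 X) := fun j p u =>
    Finset.univ.image fun a : Fin l × Fin l =>
      s(ω a.1 (fiber (f j) p u), ω a.2 (fiber (f j) (p + 1) (f j p u)))
  have hsub : (spannerGraph f L ω).edgeFinset ⊆ Finset.univ.biUnion fun j =>
      (Finset.range L).biUnion fun p => (merging (f j) p).biUnion fun u => T j p u := by
    intro e
    induction e using Sym2.ind with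
    | _ u v =>
      intro he
      rw [SimpleGraph.mem_edgeFinset, SimpleGraph.mem_edgeSet, spannerGraph,
        SimpleGraph.fromRel_adj] at he
      simp only [Finset.mem_biUnion, Finset.mem_univ, true_and, Finset.mem_range, T,
        Finset.mem_image, Prod.exists]
      rcases he.2 with ⟨j, p, hp, x, hx, a, a', rfl, rfl⟩ | ⟨j, p, hp, x, hx, a, a', rfl, rfl⟩
      · exact ⟨j, p, hp, chain (f j) p x, chain_mem_merging hx, a, a', rfl⟩
      · exact ⟨j, p, hp, chain (f j) p x, chain_mem_merging hx, a, a', Sym2.eq_swap⟩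
  refine (Finset.sum_le_sum_of_subset hsub).trans ?_
  refine (sum_biUnion_le _ _ _).trans (Finset.sum_le_sum fun j _ => ?_)
  refine (sum_biUnion_le _ _ _).trans (Finset.sum_le_sum fun p _ => ?_)
  refine (sum_biUnion_le _ _ _).trans ?_
  have hT : ∀ u ∈ merging (f j) p, ∑ e ∈ T j p u, w e ≤ (l ^ 2 : ℕ) * c j p := by
    intro u hu
    have hu' : u ∈ labels (f j) p := Finset.mem_of_mem_filter _ hu
    obtain ⟨x, -, rfl⟩ := Finset.mem_image.1 hu'
    refine (sum_image_le_sum _ _ _).trans ?_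
    refine (Finset.sum_le_card_nsmul _ _ (c j p) fun a _ => hc j p x a.1 a.2).trans ?_
    simp [sq]
  refine (Finset.sum_le_card_nsmul _ _ _ hT).trans ?_
  rw [nsmul_eq_mul]
  push_cast
  rw [mul_assoc]

open Classical in
theorem size_spannerGraph_le [MetricSpace X] [Fintype J] (f : J → ℕ → X → X) (L : ℕ) {l : ℕ}
    (ω : Fin l → Finset X → X) :
    (WGraph.ofMetric (spannerGraph f L ω)).size ≤
      Fintype.card J * (l ^ 2 * (2 * Fintype.card X)) := by
  have h1 := sum_edgeFinset_le f L (ω := ω) (fun _ => 1) (fun _ _ => 1) (fun _ _ _ _ _ => le_rfl)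
  simp only [Finset.sum_const, nsmul_eq_mul, mul_one] at h1
  have h2 : (WGraph.ofMetric (spannerGraph f L ω)).size ≤
      ∑ j, ∑ p ∈ Finset.range L, ((merging (f j) p).card * l ^ 2) := by
    unfold WGraph.size
    exact_mod_cast h1
  refine h2.trans ?_
  refine (Finset.sum_le_card_nsmul _ _ (l ^ 2 * (2 * Fintype.card X)) fun j _ => ?_).trans (by simp)
  rw [← Finset.sum_mul, mul_comm]
  gcongr
  exact sum_card_merging_le (f j) L

theorem totalWeight_spannerGraph_le [MetricSpace X] [Fintype J] (f : J → ℕ → X → X) (L : ℕ)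
    {l : ℕ} {ω : Fin l → Finset X → X} (hω : ω ∈ samples X l) (D : J → ℕ → ℝ)
    (hD : ∀ j p x y, chain (f j) p x = chain (f j) p y → dist x y ≤ D j p) :
    ((WGraph.ofMetric (spannerGraph f L ω)).totalWeight : ℝ) ≤
      ∑ j, ∑ p ∈ Finset.range L, ((merging (f j) p).card * l ^ 2 : ℝ) * D j (p + 1) := by
  classical
  rcases isEmpty_or_nonempty X with hX | hX
  · have : (WGraph.ofMetric (spannerGraph f L ω)).totalWeight = 0 := by
      unfold WGraph.totalWeight
      refine Finset.sum_eq_zero fun e _ => ?_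
      induction e using Sym2.ind with
      | _ u v => exact hX.elim u
    rw [this]
    have hm : ∀ j p, merging (f j) p = ∅ := fun j p =>
      Finset.eq_empty_of_forall_notMem fun x _ => hX.elim x
    simp [hm]
  have hD0 : ∀ j p, 0 ≤ D j p := fun j p => by
    obtain ⟨x⟩ := hX
    simpa using hD j p x x rfl
  have h := sum_edgeFinset_le f L (ω := ω) (WGraph.ofMetric (spannerGraph f L ω)).weight
    (fun j p => (D j (p + 1)).toNNReal) (fun j p x a a' => by
      simp only [WGraph.ofMetric, Sym2.lift_mk]
      rw [← NNReal.coe_le_coe, coe_nndist, Real.coe_toNNReal _ (hD0 _ _)]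
      have h1 : ω a (cluster (f j) p x) ∈ cluster (f j) (p + 1) x :=
        cluster_mono _ (Nat.le_succ p) x
          (mem_of_mem_samples hω a ⟨x, self_mem_cluster _ _ _⟩)
      have h2 : ω a' (cluster (f j) (p + 1) x) ∈ cluster (f j) (p + 1) x :=
        mem_of_mem_samples hω a' ⟨x, self_mem_cluster _ _ _⟩
      exact hD j (p + 1) _ _ ((mem_cluster.1 h1).trans (mem_cluster.1 h2).symm))
  rw [← NNReal.coe_le_coe] at h
  refine le_trans (le_of_eq ?_) (h.trans (le_of_eq ?_))
  · unfold WGraph.totalWeight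
    rfl
  · push_cast
    simp only [Real.coe_toNNReal _ (hD0 _ _)]

/-- If every cluster of which `B` misses more than a fraction `θ` has a sampled point outside `B`,
then points outside the faulty set are joined by short paths avoiding `B`. -/
theorem dist_spannerGraph_le [MetricSpace X] [Fintype J] (f : J → ℕ → X → X) (L : ℕ) {l : ℕ}
    {ω : Fin l → Finset X → X} (hω : ω ∈ samples X l) {D : J → ℕ → ℝ}
    (hD : ∀ j p x y, chain (f j) p x = chain (f j) p y → dist x y ≤ D j p) {T θ : ℝ}
    (hT : ∀ x y, x ≠ y → ∃ j, ∃ p ≤ L, chain (f j) p x = chain (f j) p y ∧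
      2 * ∑ i ∈ Finset.range p, D j (i + 1) ≤ T * dist x y)
    (B : Finset X)
    (hgood : ∀ j, ∀ p ≤ L, ∀ x, x ∉ faultySet f L θ B → ∃ a, ω a (cluster (f j) p x) ∉ B)
    (x y : ((B : Set X)ᶜ : Set X)) (hx : (x : X) ∉ faultySet f L θ B)
    (hy : (y : X) ∉ faultySet f L θ B) :
    ((WGraph.ofMetric (spannerGraph f L ω)).induce (B : Set X)ᶜ).dist x y ≤
      ENNReal.ofReal T * edist (x : X) (y : X) := by
  classical
  by_cases hxy : x = y
  · subst hxy; simp [WGraph.dist_self]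
  obtain ⟨j, p, hp, hchain, hlen⟩ := hT x y fun h => hxy (Subtype.ext h)
  set H := (WGraph.ofMetric (spannerGraph f L ω)).induce (B : Set X)ᶜ with hH
  have hD0 : ∀ q, 0 ≤ D j q := fun q => by simpa using hD j q x x rfl
  have hsel : ∀ C : Finset X, ∃ z : ((B : Set X)ᶜ : Set X),
      (∃ a, ω a C ∉ B) → ∃ a, ω a C = z := by
    intro C
    by_cases h : ∃ a, ω a C ∉ B
    · obtain ⟨a, ha⟩ := h
      exact ⟨⟨ω a C, ha⟩, fun _ => ⟨a, rfl⟩⟩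
    · exact ⟨x, fun h' => absurd h' h⟩
  choose z hz using hsel
  have hup : ∀ u : ((B : Set X)ᶜ : Set X), (u : X) ∉ faultySet f L θ B → ∀ q ≤ p,
      H.dist u (z (cluster (f j) q u)) ≤
        ENNReal.ofReal (∑ i ∈ Finset.range q, D j (i + 1)) := by
    intro u hu q
    induction q with
    | zero =>
      intro _
      obtain ⟨a, ha⟩ := hz _ (hgood j 0 (Nat.zero_le _) u hu)
      have h1 := mem_of_mem_samples hω a ⟨(u : X), self_mem_cluster (f j) 0 u⟩
      have h2 : ω a (cluster (f j) 0 u) = u := by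
        rw [cluster_zero] at h1 ⊢
        simpa using h1
      have h3 : u = z (cluster (f j) 0 u) := Subtype.ext (h2.symm.trans ha)
      rw [← h3, WGraph.dist_self]
      exact zero_le
    | succ q ih =>
      intro hq
      refine (WGraph.dist_triangle H _ (z (cluster (f j) q u)) _).trans ?_
      rw [Finset.sum_range_succ, ENNReal.ofReal_add (Finset.sum_nonneg fun i _ => hD0 _) (hD0 _)]
      refine add_le_add (ih (by omega)) ?_
      obtain ⟨a, ha⟩ := hz _ (hgood j q (by omega) u hu)
      obtain ⟨a', ha'⟩ := hz _ (hgood j (q + 1) (by omega) u hu)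
      have h1 := cluster_mono (f j) (Nat.le_succ q) u
        (mem_of_mem_samples hω a ⟨(u : X), self_mem_cluster (f j) q u⟩)
      have h2 := mem_of_mem_samples hω a' ⟨(u : X), self_mem_cluster (f j) (q + 1) u⟩
      rw [ha] at h1
      rw [ha'] at h2
      refine (WGraph.dist_induce_ofMetric_le _ _ ?_).trans ?_
      · by_cases hne : z (cluster (f j) q u) = z (cluster (f j) (q + 1) u)
        · exact Or.inr hne
        · left
          rw [spannerGraph, SimpleGraph.fromRel_adj]
          refine ⟨fun h => hne (Subtype.ext h), Or.inl ⟨j, q, by omega, u, fun h => hne ?_, a, a',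
            ha.symm, ha'.symm⟩⟩
          rw [h]
      · rw [edist_dist]
        exact ENNReal.ofReal_le_ofReal (hD j _ _ _
          ((mem_cluster.1 h1).trans (mem_cluster.1 h2).symm))
  have h1 := hup x hx p le_rfl
  have h2 := hup y hy p le_rfl
  rw [← cluster_eq_of_chain_eq hchain] at h2
  have hS : 0 ≤ ∑ i ∈ Finset.range p, D j (i + 1) := Finset.sum_nonneg fun i _ => hD0 _
  calc H.dist x y ≤ H.dist x (z (cluster (f j) p x)) + H.dist (z (cluster (f j) p x)) y :=
        WGraph.dist_triangle H _ _ _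
    _ ≤ ENNReal.ofReal (∑ i ∈ Finset.range p, D j (i + 1)) +
        ENNReal.ofReal (∑ i ∈ Finset.range p, D j (i + 1)) := by
        rw [WGraph.dist_comm H _ y]
        exact add_le_add h1 h2
    _ = ENNReal.ofReal (2 * ∑ i ∈ Finset.range p, D j (i + 1)) := by
        rw [← ENNReal.ofReal_add hS hS, two_mul]
    _ ≤ ENNReal.ofReal (T * dist (x : X) y) := ENNReal.ofReal_le_ofReal hlen
    _ = _ := by rw [ENNReal.ofReal_mul' dist_nonneg, edist_dist]

/-- Oblivious reliable spanners from finitely many hierarchies of partitions such that every pair of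
points is close in one of them. -/
theorem exists_spanner_of_hierarchies [MetricSpace X] [Nonempty X] [Fintype J] [Nonempty J]
    (f : J → ℕ → X → X) (L l : ℕ) (D : J → ℕ → ℝ)
    (hD : ∀ j p x y, chain (f j) p x = chain (f j) p y → dist x y ≤ D j p) {T ν : ℝ}
    (hT : ∀ x y, x ≠ y → ∃ j, ∃ p ≤ L, chain (f j) p x = chain (f j) p y ∧
      2 * ∑ i ∈ Finset.range p, D j (i + 1) ≤ T * dist x y)
    (hν : 0 < ν) (hν1 : ν ≤ 1) (hl : 1 ≤ l)
    (hfail : (Fintype.card X : ℝ) ^ 3 * Fintype.card J * (1 - ν / (4 * Fintype.card J)) ^ l ≤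
      ν / 2) :
    ∃ P : PMF (WGraph X), IsObliviousReliableSpanner ν T P ∧ ∀ H ∈ P.support,
      H.size ≤ Fintype.card J * (l ^ 2 * (2 * Fintype.card X)) ∧
      (H.totalWeight : ℝ) ≤
        ∑ j, ∑ p ∈ Finset.range L, ((merging (f j) p).card * l ^ 2 : ℝ) * D j (p + 1) := by
  classical
  set g : (Fin l → Finset X → X) → WGraph X := fun ω => WGraph.ofMetric (spannerGraph f L ω)
  have hJ : (1 : ℝ) ≤ Fintype.card J := by exact_mod_cast Fintype.card_pos (α := J)
  set θ : ℝ := ν / (4 * Fintype.card J) with hθ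
  have hθ0 : 0 < θ := by positivity
  have hθ4 : θ * Fintype.card J = ν / 4 := by rw [hθ]; field_simp
  have hθ1 : θ ≤ 1 / 4 := by
    have : θ * 1 ≤ θ * Fintype.card J := by gcongr
    linarith
  have hsupp : ∀ H ∈ ((PMF.uniformOfFinset (samples X l) (samples_nonempty l)).map g).support,
      ∃ ω ∈ samples X l, g ω = H := by
    intro H hH
    rw [PMF.mem_support_map_iff] at hH
    obtain ⟨ω, hω, rfl⟩ := hH
    exact ⟨ω, by simpa using hω, rfl⟩
  refine ⟨(PMF.uniformOfFinset (samples X l) (samples_nonempty l)).map g, ⟨?_, ?_⟩, ?_⟩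
  · intro H hH
    obtain ⟨ω, -, rfl⟩ := hsupp H hH
    exact WGraph.ofMetric_dominates _
  · intro B
    let ok : WGraph X → Prop := fun H => ∀ x y : ((B : Set X)ᶜ : Set X),
      (x : X) ∉ faultySet f L θ B → (y : X) ∉ faultySet f L θ B →
        (H.induce (B : Set X)ᶜ).dist x y ≤ ENNReal.ofReal T * edist (x : X) (y : X)
    let bad : (Fin l → Finset X → X) → Prop := fun ω => ∃ j, ∃ C ∈ clusters (f j) L,
      θ * C.card < ((C \ B).card : ℝ) ∧ ∀ a, ω a C ∈ B
    have hok : ∀ ω ∈ samples X l, ¬ bad ω → ok (g ω) := by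
      intro ω hω hbad x y hx hy
      refine dist_spannerGraph_le f L hω hD hT B (fun j p hp x hx => ?_) x y hx hy
      by_contra! hcon
      refine hbad ⟨j, _, mem_clusters.2 ⟨p, x, hp, rfl⟩, ?_, hcon⟩
      convert lt_card_sdiff_of_notMem_faultySet hx j hp
    refine ⟨fun H => if ok H then faultySet f L θ B else Finset.univ, fun H _ => ⟨?_, ?_⟩, ?_⟩
    · beta_reduce
      split_ifs
      · exact subset_faultySet _ _ _ _
      · exact Finset.subset_univ _
    · intro x y hx hy
      beta_reduce at hx hy
      by_cases h : ok H
      · rw [if_pos h] at hx hy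
        exact h x y hx hy
      · rw [if_neg h] at hx
        exact absurd (Finset.mem_univ _) hx
    · have hbadcard : ((samples X l).filter bad).card * (Fintype.card X : ℝ) ≤
          ν / 2 * B.card * (samples X l).card := by
        rcases B.eq_empty_or_nonempty with rfl | hB
        · have : (samples X l).filter bad = ∅ := by
            refine Finset.filter_false_of_mem fun ω _ => ?_
            rintro ⟨j, C, -, -, hC⟩
            simpa using hC ⟨0, hl⟩
          simp [this]
        have hsub : (samples X l).filter bad ⊆ Finset.univ.biUnion fun j =>
            ((clusters (f j) L).filter fun C => θ * C.card < ((C \ B).card : ℝ)).biUnion fun C =>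
              (samples X l).filter fun ω => ∀ a, ω a C ∈ B := by
          intro ω hω
          simp only [Finset.mem_filter, bad] at hω
          obtain ⟨hω, j, C, hC, h1, h2⟩ := hω
          simp only [Finset.mem_biUnion, Finset.mem_filter, Finset.mem_univ, true_and]
          exact ⟨j, C, ⟨hC, h1⟩, hω, h2⟩
        have h1 : (((samples X l).filter bad).card : ℝ) ≤ ∑ j : J,
            (Fintype.card X * Fintype.card X : ℕ) * ((1 - θ) ^ l * (samples X l).card) := by
          refine (Nat.cast_le.2 ((Finset.card_le_card hsub).trans Finset.card_biUnion_le)).trans ?_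
          push_cast
          refine Finset.sum_le_sum fun j _ => ?_
          refine (Nat.cast_le.2 Finset.card_biUnion_le).trans ?_
          push_cast
          refine (Finset.sum_le_card_nsmul _ _ ((1 - θ) ^ l * (samples X l).card)
            fun C hC => ?_).trans ?_
          · exact card_samples_filter_le l
              (nonempty_of_mem_clusters (Finset.mem_filter.1 hC).1) (Finset.mem_filter.1 hC).2
          · rw [nsmul_eq_mul]
            have h0 : 0 ≤ (1 - θ) ^ l := pow_nonneg (by linarith) _
            gcongr
            exact_mod_cast (Finset.card_filter_le _ _).trans
              ((isLaminar_clusters (f j) L).card_le fun C hC => nonempty_of_mem_clusters hC)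
        rw [Finset.sum_const, Finset.card_univ, nsmul_eq_mul] at h1
        push_cast at h1
        have hB1 : (1 : ℝ) ≤ B.card := by exact_mod_cast Finset.card_pos.2 hB
        calc ((samples X l).filter bad).card * (Fintype.card X : ℝ)
            ≤ Fintype.card J * (Fintype.card X * Fintype.card X *
              ((1 - θ) ^ l * (samples X l).card)) * Fintype.card X := by gcongr
          _ = (Fintype.card X : ℝ) ^ 3 * Fintype.card J * (1 - θ) ^ l * (samples X l).card := by
              ring
          _ ≤ ν / 2 * (samples X l).card := by gcongr
          _ ≤ ν / 2 * B.card * (samples X l).card := by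
              gcongr
              exact le_mul_of_one_le_right (by positivity) hB1
      have hM := card_faultySet_le f L hθ0.le (by linarith) B
      have hfin := tsum_map_uniform_le (samples X l) (samples_nonempty l) g
        (fun H => (if ok H then faultySet f L θ B else Finset.univ).card) bad
        (faultySet f L θ B).card (Fintype.card X)
        (fun ω hω hb => by simp only [if_pos (hok ω hω hb), le_refl])
        (fun ω _ => Finset.card_le_univ _) ((1 + ν) * B.card) (by
          have hSpos : (0 : ℝ) < (samples X l).card := by
            exact_mod_cast Finset.card_pos.2 (samples_nonempty l)
          have h2 : (Fintype.card X : ℝ) * ((samples X l).filter bad).card / (samples X l).card ≤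
              ν / 2 * B.card := by
            rw [div_le_iff₀ hSpos, mul_comm (Fintype.card X : ℝ)]
            exact hbadcard
          have h3 : (1 + 2 * θ * Fintype.card J) * (B.card : ℝ) = (1 + ν / 2) * B.card := by
            rw [mul_assoc 2, hθ4]; ring
          rw [h3] at hM
          refine le_trans (add_le_add hM (le_of_eq_of_le ?_ h2)) (by linarith)
          congr)
      rw [ENNReal.ofReal_mul (by linarith), ENNReal.ofReal_natCast] at hfin
      exact hfin
  · intro H hH
    obtain ⟨ω, hω, rfl⟩ := hsupp H hH
    exact ⟨size_spannerGraph_le f L ω, totalWeight_spannerGraph_le f L hω D hD⟩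

end Spanner

section Hierarchy

variable {X : Type*}

/-- The sequence `N 0, F 0, N 1, F 1, …`. -/
def interleave (N F : ℕ → X → X) (p : ℕ) : X → X :=
  if p % 2 = 0 then N (p / 2) else F (p / 2)

theorem interleave_even (N F : ℕ → X → X) (a : ℕ) : interleave N F (2 * a) = N a := by
  simp [interleave]

theorem interleave_odd (N F : ℕ → X → X) (a : ℕ) : interleave N F (2 * a + 1) = F a := by
  have h1 : (2 * a + 1) % 2 ≠ 0 := by omega
  have h2 : (2 * a + 1) / 2 = a := by omega
  rw [interleave, if_neg h1, h2]

/-- A bound for the diameters of the clusters of level `p` of a hierarchy in which the scale of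
`N a` is `R a / b` and the scale of `F a` is `R a`. -/
noncomputable def levelDiam (R : ℕ → ℝ) (b : ℝ) (p : ℕ) : ℝ :=
  if p % 2 = 1 then 6 * R (p / 2) / b else 2 * R (p / 2 - 1) + 6 * R (p / 2 - 1) / b

theorem levelDiam_odd (R : ℕ → ℝ) (b : ℝ) (a : ℕ) :
    levelDiam R b (2 * a + 1) = 6 * R a / b := by
  have h1 : (2 * a + 1) % 2 = 1 := by omega
  have h2 : (2 * a + 1) / 2 = a := by omega
  rw [levelDiam, if_pos h1, h2]

theorem levelDiam_even (R : ℕ → ℝ) (b : ℝ) (a : ℕ) :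
    levelDiam R b (2 * a + 2) = 2 * R a + 6 * R a / b := by
  have h1 : (2 * a + 2) % 2 ≠ 1 := by omega
  have h2 : (2 * a + 2) / 2 - 1 = a := by omega
  rw [levelDiam, if_neg h1, h2]

theorem sum_range_two_mul (g : ℕ → ℝ) (m : ℕ) :
    ∑ i ∈ Finset.range (2 * m), g i = ∑ a ∈ Finset.range m, (g (2 * a) + g (2 * a + 1)) := by
  induction m with
  | zero => simp
  | succ m ih =>
    rw [show 2 * (m + 1) = 2 * m + 1 + 1 by ring, Finset.sum_range_succ, Finset.sum_range_succ, ih,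
      Finset.sum_range_succ]
    ring

theorem sum_levelDiam_le {R : ℕ → ℝ} {b : ℝ} (hR : ∀ a, 0 < R a) (hb : 15 ≤ b)
    (hRb : ∀ a, R (a + 1) = R a * b) (a : ℕ) :
    ∑ i ∈ Finset.range (2 * a + 2), levelDiam R b (i + 1) ≤ 2 * R a + 15 * R a / b := by
  have hb0 : 0 < b := by linarith
  have step : ∀ a, ∑ i ∈ Finset.range (2 * a), levelDiam R b (i + 1) ≤ 3 * R a / b →
      ∑ i ∈ Finset.range (2 * a + 2), levelDiam R b (i + 1) ≤ 2 * R a + 15 * R a / b := by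
    intro a h
    rw [Finset.sum_range_succ, Finset.sum_range_succ, levelDiam_odd, levelDiam_even]
    have : 15 * R a / b = 3 * R a / b + 6 * R a / b + 6 * R a / b := by ring
    linarith
  refine step a ?_
  induction a with
  | zero => simpa using div_nonneg (mul_nonneg zero_le_three (hR 0).le) hb0.le
  | succ a ih =>
    refine (step a ih).trans ?_
    rw [hRb, ← mul_assoc, mul_div_cancel_right₀ _ hb0.ne']
    have : 15 * R a / b ≤ R a := by
      rw [div_le_iff₀ hb0, mul_comm]
      exact mul_le_mul_of_nonneg_left hb (hR a).le
    linarith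

variable [MetricSpace X]

theorem dist_chain_interleave_le {R : ℕ → ℝ} {b : ℝ} (hR : ∀ a, 0 < R a) (hb : 15 ≤ b)
    (hRb : ∀ a, R (a + 1) = R a * b) {N F : ℕ → X → X} (hN : ∀ a x, dist x (N a x) ≤ R a / b)
    (hF : ∀ a x, dist x (F a x) ≤ R a) (a : ℕ) (x : X) :
    dist x (chain (interleave N F) (2 * a + 1) x) ≤ 3 * R a / b ∧
      dist x (chain (interleave N F) (2 * a + 2) x) ≤ R a + 3 * R a / b := by
  have hb0 : 0 < b := by linarith
  have step : ∀ a, dist x (chain (interleave N F) (2 * a) x) ≤ 2 * R a / b →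
      dist x (chain (interleave N F) (2 * a + 1) x) ≤ 3 * R a / b ∧
      dist x (chain (interleave N F) (2 * a + 2) x) ≤ R a + 3 * R a / b := by
    intro a h
    have h1 : dist x (chain (interleave N F) (2 * a + 1) x) ≤ 3 * R a / b := by
      rw [chain, Function.comp_apply, interleave_even]
      have h2 := dist_triangle x (chain (interleave N F) (2 * a) x)
        (N a (chain (interleave N F) (2 * a) x))
      have h3 := hN a (chain (interleave N F) (2 * a) x)
      have : 3 * R a / b = 2 * R a / b + R a / b := by ring
      linarith
    refine ⟨h1, ?_⟩
    rw [chain, Function.comp_apply, interleave_odd]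
    have h2 := dist_triangle x (chain (interleave N F) (2 * a + 1) x)
      (F a (chain (interleave N F) (2 * a + 1) x))
    have h3 := hF a (chain (interleave N F) (2 * a + 1) x)
    linarith
  refine step a ?_
  induction a with
  | zero => simpa [chain] using div_nonneg (mul_nonneg zero_le_two (hR 0).le) hb0.le
  | succ a ih =>
    refine (step a ih).2.trans ?_
    rw [hRb, ← mul_assoc, mul_div_cancel_right₀ _ hb0.ne']
    have : 3 * R a / b ≤ R a := by
      rw [div_le_iff₀ hb0, mul_comm]
      exact mul_le_mul_of_nonneg_left (by linarith) (hR a).le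
    linarith

theorem dist_le_levelDiam {R : ℕ → ℝ} {b : ℝ} (hR : ∀ a, 0 < R a) (hb : 15 ≤ b)
    (hRb : ∀ a, R (a + 1) = R a * b) {N F : ℕ → X → X} (hN : ∀ a x, dist x (N a x) ≤ R a / b)
    (hF : ∀ a x, dist x (F a x) ≤ R a) (p : ℕ) (x y : X)
    (h : chain (interleave N F) p x = chain (interleave N F) p y) :
    dist x y ≤ levelDiam R b p := by
  have hb0 : 0 < b := by linarith
  have htri : dist x y ≤ dist x (chain (interleave N F) p x) +
      dist y (chain (interleave N F) p y) := by
    have := dist_triangle_right x y (chain (interleave N F) p x)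
    rwa [h] at this ⊢
  rcases Nat.even_or_odd' p with ⟨c, rfl | rfl⟩
  · cases c with
    | zero =>
      have hxy : x = y := h
      subst hxy
      rw [dist_self]
      have := hR 0
      simp only [levelDiam]
      positivity
    | succ a =>
      rw [show 2 * (a + 1) = 2 * a + 2 by ring] at *
      have h1 := (dist_chain_interleave_le hR hb hRb hN hF a x).2
      have h2 := (dist_chain_interleave_le hR hb hRb hN hF a y).2
      rw [levelDiam_even]
      have : 6 * R a / b = 3 * R a / b + 3 * R a / b := by ring
      linarith
  · have h1 := (dist_chain_interleave_le hR hb hRb hN hF c x).1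
    have h2 := (dist_chain_interleave_le hR hb hRb hN hF c y).1
    rw [levelDiam_odd]
    have : 6 * R c / b = 3 * R c / b + 3 * R c / b := by ring
    linarith

theorem chain_eq_of_isConstOn {R : ℕ → ℝ} {b : ℝ} (hR : ∀ a, 0 < R a) (hb : 15 ≤ b)
    (hRb : ∀ a, R (a + 1) = R a * b) {N F : ℕ → X → X} (hN : ∀ a x, dist x (N a x) ≤ R a / b)
    (hF : ∀ a x, dist x (F a x) ≤ R a) {a : ℕ} {x y : X}
    (h : IsConstOn (F a) (Metric.closedBall x (3 * R a / b) ∪ Metric.closedBall y (3 * R a / b))) :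
    chain (interleave N F) (2 * a + 2) x = chain (interleave N F) (2 * a + 2) y := by
  obtain ⟨v, hv⟩ := h
  have h1 := (dist_chain_interleave_le hR hb hRb hN hF a x).1
  have h2 := (dist_chain_interleave_le hR hb hRb hN hF a y).1
  rw [chain, Function.comp_apply, Function.comp_apply, interleave_odd,
    hv _ (Or.inl (Metric.mem_closedBall'.2 h1)), hv _ (Or.inr (Metric.mem_closedBall'.2 h2))]

end Hierarchy

section HierarchyWeight

variable {X : Type*} [Fintype X]

theorem card_merging_le_sub_one [Nonempty X] (f : ℕ → X → X) (p : ℕ) :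
    ((merging f p).card : ℝ) ≤ 2 * ((labels f p).card - 1) := by
  have h1 := card_merging_add_le f p
  have h2 : 1 ≤ (labels f (p + 1)).card := by
    classical
    exact Finset.card_pos.2 (Finset.univ_nonempty.image _)
  have h3 : (merging f p).card + 2 ≤ 2 * (labels f p).card := by omega
  have h4 : ((merging f p).card : ℝ) + 2 ≤ 2 * (labels f p).card := by exact_mod_cast h3
  linarith

open Classical in
theorem card_labels_interleave_le (N F : ℕ → X → X) (a : ℕ) :
    (labels (interleave N F) (2 * a + 1)).card ≤ (Finset.univ.image (N a)).card ∧
      (labels (interleave N F) (2 * a + 2)).card ≤ (Finset.univ.image (N a)).card := by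
  have h1 : (labels (interleave N F) (2 * a + 1)).card ≤ (Finset.univ.image (N a)).card := by
    rw [labels_succ, interleave_even]
    exact Finset.card_le_card (Finset.image_subset_image (Finset.subset_univ _))
  refine ⟨h1, le_trans ?_ h1⟩
  rw [labels_succ (interleave N F) (2 * a + 1)]
  exact Finset.card_image_le

open Classical in
theorem sum_merging_mul_levelDiam_le [Nonempty X] {R : ℕ → ℝ} {b W : ℝ} (hR : ∀ a, 0 < R a)
    (hb : 15 ≤ b) (hRb : ∀ a, R a = R 0 * b ^ a) (N F : ℕ → X → X)
    (hNcard : ∀ a, ((Finset.univ.image (N a)).card - 1 : ℝ) * (R a / b) ≤ 2 * W) {q M : ℕ}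
    (hq : Fintype.card X ≤ 2 ^ q) (hqM : q + 1 ≤ M) :
    ∑ p ∈ Finset.range (2 * (M + 1)),
        ((merging (interleave N F) p).card : ℝ) * levelDiam R b (p + 1) ≤
      36 * (q + 1) * b * W + 6 * R M := by
  have hb0 : 0 < b := by linarith
  set f := interleave N F with hf
  have hnet : ∀ a, ((Finset.univ.image (N a)).card - 1 : ℝ) * R a ≤ 2 * W * b := by
    intro a
    have := hNcard a
    rw [← mul_div_assoc, div_le_iff₀ hb0] at this
    exact this
  have hodd : ∀ a, ((merging f (2 * a + 1)).card : ℝ) * R a ≤ 4 * b * W := by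
    intro a
    have h1 := card_merging_le_sub_one f (2 * a + 1)
    have h2 : ((labels f (2 * a + 1)).card : ℝ) ≤ (Finset.univ.image (N a)).card := by
      exact_mod_cast (card_labels_interleave_le N F a).1
    have h3 : ((merging f (2 * a + 1)).card : ℝ) ≤
      2 * ((Finset.univ.image (N a)).card - 1) := by linarith
    have h4 := mul_le_mul_of_nonneg_right h3 (hR a).le
    have h5 := hnet a
    linarith
  have heven : ∀ a, ((merging f (2 * a + 2)).card : ℝ) * R a ≤ 4 * b * W := by
    intro a
    have h1 := card_merging_le_sub_one f (2 * a + 2)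
    have h2 : ((labels f (2 * a + 2)).card : ℝ) ≤ (Finset.univ.image (N a)).card := by
      exact_mod_cast (card_labels_interleave_le N F a).2
    have h3 : ((merging f (2 * a + 2)).card : ℝ) ≤
      2 * ((Finset.univ.image (N a)).card - 1) := by linarith
    have h4 := mul_le_mul_of_nonneg_right h3 (hR a).le
    have h5 := hnet a
    linarith
  have hsmallR : ∀ a, 6 * R a / b ≤ R a / 2 := by
    intro a
    rw [div_le_iff₀ hb0]
    nlinarith [hR a]
  set g : ℕ → ℝ := fun p => ((merging f p).card : ℝ) * levelDiam R b (p + 1)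
  have hlarge : ∀ a, g (2 * (a + 1)) + g (2 * (a + 1) + 1) ≤ 36 * b * W := by
    intro a
    have h1 : g (2 * (a + 1)) = 6 * (((merging f (2 * a + 2)).card : ℝ) * R a) := by
      change ((merging f (2 * (a + 1))).card : ℝ) * levelDiam R b (2 * (a + 1) + 1) = _
      rw [levelDiam_odd, show R (a + 1) = R a * b by rw [hRb (a + 1), hRb a, pow_succ]; ring,
        show 2 * (a + 1) = 2 * a + 2 by ring, ← mul_assoc 6, mul_div_cancel_right₀ _ hb0.ne']
      ring
    have h2 : g (2 * (a + 1) + 1) ≤ 3 * (((merging f (2 * (a + 1) + 1)).card : ℝ) * R (a + 1)) := by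
      change ((merging f (2 * (a + 1) + 1)).card : ℝ) * levelDiam R b (2 * (a + 1) + 2) ≤ _
      rw [levelDiam_even, mul_left_comm]
      refine mul_le_mul_of_nonneg_left ?_ (Nat.cast_nonneg _)
      linarith [hsmallR (a + 1), hR (a + 1)]
    have h3 := heven a
    have h4 := hodd (a + 1)
    linarith
  have hmn : ∀ p, ((merging f p).card : ℝ) ≤ 2 * Fintype.card X := by
    intro p
    have h1 := card_merging_add_le f p
    have h2 : (labels f p).card ≤ Fintype.card X := Finset.card_le_univ _
    have h3 : (merging f p).card ≤ 2 * Fintype.card X := by omega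
    exact_mod_cast h3
  have hsmall : ∀ a, g (2 * a) + g (2 * a + 1) ≤ 6 * Fintype.card X * R a := by
    intro a
    have hRa := hR a
    have h1 : g (2 * a) ≤ 2 * Fintype.card X * (6 * R a / b) := by
      change ((merging f (2 * a)).card : ℝ) * levelDiam R b (2 * a + 1) ≤ _
      rw [levelDiam_odd]
      gcongr
      exact hmn _
    have h2 : g (2 * a + 1) ≤ 2 * Fintype.card X * (2 * R a + 6 * R a / b) := by
      change ((merging f (2 * a + 1)).card : ℝ) * levelDiam R b (2 * a + 2) ≤ _
      rw [levelDiam_even]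
      gcongr
      exact hmn _
    have h3 : 2 * (Fintype.card X : ℝ) * (6 * R a / b) ≤ 2 * Fintype.card X * (R a / 2) :=
      mul_le_mul_of_nonneg_left (hsmallR a) (by positivity)
    linarith
  rw [sum_range_two_mul, ← Finset.sum_range_add_sum_Ico _ (show M - q ≤ M + 1 by omega)]
  have hA : ∑ a ∈ Finset.range (M - q), (g (2 * a) + g (2 * a + 1)) ≤ 6 * R M := by
    have hgeom : ∀ m : ℕ, ∑ a ∈ Finset.range m, R a ≤ R m := by
      intro m
      induction m with
      | zero => simpa using (hR 0).le
      | succ m ih =>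
        rw [Finset.sum_range_succ, hRb (m + 1), pow_succ, ← mul_assoc, ← hRb m]
        nlinarith [hR m]
    have hn : (Fintype.card X : ℝ) * R (M - q) ≤ R M := by
      have h1 : (Fintype.card X : ℝ) ≤ b ^ q := by
        calc (Fintype.card X : ℝ) ≤ (2 : ℝ) ^ q := by exact_mod_cast hq
          _ ≤ b ^ q := by gcongr; linarith
      have h2 : R M = b ^ q * R (M - q) := by
        rw [hRb M, hRb (M - q)]
        have : M = q + (M - q) := by omega
        conv_lhs => rw [this, pow_add]
        ring
      rw [h2]
      have := hR (M - q)
      gcongr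
    calc ∑ a ∈ Finset.range (M - q), (g (2 * a) + g (2 * a + 1))
        ≤ ∑ a ∈ Finset.range (M - q), 6 * Fintype.card X * R a :=
          Finset.sum_le_sum fun a _ => hsmall a
      _ = 6 * Fintype.card X * ∑ a ∈ Finset.range (M - q), R a := by rw [Finset.mul_sum]
      _ ≤ 6 * Fintype.card X * R (M - q) := by gcongr; exact hgeom _
      _ ≤ 6 * R M := by linarith
  have hB : ∑ a ∈ Finset.Ico (M - q) (M + 1), (g (2 * a) + g (2 * a + 1)) ≤
      36 * (q + 1) * b * W := by
    refine (Finset.sum_le_card_nsmul _ _ (36 * b * W) fun a ha => ?_).trans ?_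
    · rw [Finset.mem_Ico] at ha
      obtain ⟨c, rfl⟩ : ∃ c, a = c + 1 := ⟨a - 1, by omega⟩
      exact hlarge c
    · rw [Nat.card_Ico, show M + 1 - (M - q) = q + 1 by omega, nsmul_eq_mul]
      push_cast
      linarith
  linarith

end HierarchyWeight

section General

variable {X : Type*} [MetricSpace X] [Fintype X]

/-- At every scale `R` there are `P` partitions into clusters of radius `R` such that the balls of
radius `3 * R / b` around any two points of distance at most `R * (1 / k - 6 / b)` are in a common
cluster of one of them. -/
theorem exists_pairwise_partition_cover {k : ℕ} (hk : 1 ≤ k) {p b R : ℝ} (hp : 0 < p)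
    (hp1 : p ≤ 1) (hpk : p ^ k * Fintype.card X ≤ 1) (P : ℕ)
    (hP : (1 - p) ^ P * (Fintype.card X : ℝ) ^ 2 < 1) (hb : 0 < b) (hR : 0 < R) :
    ∃ F : Fin P → X → X, (∀ c x, dist x (F c x) ≤ R) ∧
      ∀ x y, dist x y ≤ R * (1 / k - 6 / b) →
        ∃ c, IsConstOn (F c) (Metric.closedBall x (3 * R / b) ∪ Metric.closedBall y (3 * R / b)) := by
  classical
  have hk0 : (0 : ℝ) < k := by exact_mod_cast hk
  let ι := {z : X × X // dist z.1 z.2 ≤ R * (1 / k - 6 / b)}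
  have hr : 0 ≤ 3 * R / b := by positivity
  obtain ⟨F, hF1, hF2⟩ := exists_partition_cover (ι := ι) hk (ρ := R / k) (by positivity) hp hp1 hpk
    (fun z => Metric.closedBall z.1.1 (3 * R / b) ∪ Metric.closedBall z.1.2 (3 * R / b))
    (fun z => ⟨z.1.1, Or.inl (Metric.mem_closedBall_self hr)⟩)
    (by
      rintro ⟨⟨x, y⟩, hz⟩ u hu v hv
      have hz : dist x y ≤ R * (1 / k - 6 / b) := hz
      have h0 := dist_nonneg (x := x) (y := y)
      have h1 : R / k = R * (1 / k - 6 / b) + 3 * R / b + 3 * R / b := by ring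
      simp only [Set.mem_union, Metric.mem_closedBall] at hu hv
      rcases hu with hu | hu <;> rcases hv with hv | hv
      · have := dist_triangle_right u v x
        linarith
      · have := dist_triangle4 u x y v
        rw [dist_comm y v] at this
        linarith
      · have := dist_triangle4 u y x v
        rw [dist_comm x v, dist_comm y x] at this
        linarith
      · have := dist_triangle_right u v y
        linarith)
    Finset.univ P (by
      refine lt_of_le_of_lt ?_ hP
      have h0 : 0 ≤ (1 - p) ^ P := pow_nonneg (by linarith) _
      gcongr
      have : Fintype.card ι ≤ Fintype.card (X × X) := Fintype.card_subtype_le _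
      rw [Fintype.card_prod] at this
      rw [Finset.card_univ, sq]
      exact_mod_cast this)
  refine ⟨F, fun c x => (hF1 c x).trans_eq (by field_simp), fun x y hxy => ?_⟩
  exact hF2 ⟨(x, y), hxy⟩ (Finset.mem_univ _)

theorem exists_light_spanner [Nontrivial X] {k : ℕ} (hk : 1 ≤ k) {p β T ν : ℝ} {S P l q : ℕ}
    (hp : 0 < p) (hp1 : p ≤ 1) (hpk : p ^ k * Fintype.card X ≤ 1)
    (hP : (1 - p) ^ P * (Fintype.card X : ℝ) ^ 2 < 1) (hβ : 1 < β) (hb : 15 ≤ β ^ S)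
    (hbk : 12 * k ≤ β ^ S) (hT0 : 0 ≤ T)
    (hT : β * (4 + 30 / β ^ S) ≤ T * (1 / k - 6 / β ^ S)) (hν : 0 < ν) (hν1 : ν ≤ 1)
    (hl : 1 ≤ l)
    (hfail : (Fintype.card X : ℝ) ^ 3 * (S * P : ℕ) * (1 - ν / (4 * (S * P : ℕ))) ^ l ≤ ν / 2)
    (hq : Fintype.card X ≤ 2 ^ q) :
    ∃ D : PMF (WGraph X), IsObliviousReliableSpanner ν T D ∧ ∀ H ∈ D.support,
      H.size ≤ S * P * (l ^ 2 * (2 * Fintype.card X)) ∧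
      (H.totalWeight : ℝ) ≤
        (S * P : ℕ) * (l : ℝ) ^ 2 * (36 * (q + 1) * β ^ S + 24 * k) * mstWeight X := by
  classical
  set b := β ^ S with hbdef
  set W : ℝ := (mstWeight X : ℝ) with hW
  have hb0 : 0 < b := by linarith
  have hβ0 : 0 < β := by linarith
  have hk0 : (0 : ℝ) < k := by exact_mod_cast hk
  have hW0 : 0 < W := by
    obtain ⟨x, y, hxy⟩ := exists_pair_ne X
    have := dist_le_two_mul_mstWeight x y
    have := dist_pos.2 hxy
    linarith
  have hS : 0 < S := by
    rcases Nat.eq_zero_or_pos S with h | h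
    · rw [hbdef, h, pow_zero] at hb; norm_num at hb
    · exact h
  have hPpos : 0 < P := by
    rcases Nat.eq_zero_or_pos P with h | h
    · rw [h, pow_zero, one_mul] at hP
      have h1 : (1 : ℝ) ≤ Fintype.card X := by exact_mod_cast Fintype.card_pos (α := X)
      nlinarith
    · exact h
  have hone : 1 / (2 * k) ≤ 1 / (k : ℝ) - 6 / b := by
    have h1 : 6 / b ≤ 1 / (2 * k) := by
      rw [div_le_div_iff₀ hb0 (by positivity)]
      linarith
    have h2 : 1 / (k : ℝ) = 1 / (2 * k) + 1 / (2 * k) := by field_simp; norm_num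
    linarith
  set u : ℝ := 4 * k * W * (1 / k - 6 / b) with hu
  have huW : 2 * W ≤ u := by
    have h1 : 4 * k * W * (1 / (2 * k)) ≤ u := by rw [hu]; gcongr
    have h2 : 4 * k * W * (1 / (2 * k)) = 2 * W := by field_simp; ring
    linarith
  have hu0 : 0 < u := by linarith
  have hb1 : 1 < b := by linarith
  have hM : ∃ M : ℕ, q + 1 ≤ M ∧ ∀ x y : X, x ≠ y → u / dist x y < b ^ (M + 1) := by
    have h1 : ∀ z : X × X, ∃ m : ℕ, u / dist z.1 z.2 < b ^ m := fun z =>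
      pow_unbounded_of_one_lt _ hb1
    choose m hm using h1
    refine ⟨q + 1 + ∑ z, m z, by omega, fun x y _ => (hm (x, y)).trans_le ?_⟩
    refine pow_le_pow_right₀ hb1.le ?_
    have : m (x, y) ≤ ∑ z, m z := Finset.single_le_sum (fun _ _ => Nat.zero_le _)
      (Finset.mem_univ (x, y))
    omega
  obtain ⟨M, hqM, hM⟩ := hM
  let R : Fin S → ℕ → ℝ := fun s a => 4 * k * W / (β ^ (s : ℕ) * b ^ M) * b ^ a
  have hR : ∀ s a, 0 < R s a := fun s a => by positivity
  have hRb : ∀ s a, R s (a + 1) = R s a * b := fun s a => by simp only [R, pow_succ]; ring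
  have hRb' : ∀ s a, R s a = R s 0 * b ^ a := fun s a => by simp [R]
  have hnet : ∀ s a, ∃ f : X → X, (∀ x, dist x (f x) ≤ R s a / b) ∧
      ((Finset.univ.image f).card - 1 : ℝ) * (R s a / b) ≤ 2 * W := fun s a =>
    exists_net_map (div_pos (hR s a) hb0)
  choose N hN1 hN2 using hnet
  have hpart := fun s a => exists_pairwise_partition_cover (X := X) hk hp hp1 hpk P hP hb0 (hR s a)
  choose F hF1 hF2 using hpart
  have : Nonempty (Fin S × Fin P) := ⟨(⟨0, hS⟩, ⟨0, hPpos⟩)⟩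
  have hJ : Fintype.card (Fin S × Fin P) = S * P := by simp
  obtain ⟨D, hD1, hD2⟩ := exists_spanner_of_hierarchies (J := Fin S × Fin P)
    (fun j => interleave (N j.1) fun a => F j.1 a j.2) (2 * (M + 1)) l
    (fun j => levelDiam (R j.1) b) (T := T) (ν := ν)
    (fun j => dist_le_levelDiam (hR j.1) hb (hRb j.1) (hN1 j.1) fun a => hF1 j.1 a j.2)
    (fun x y hxy => by
      have hd : 0 < dist x y := dist_pos.2 hxy
      have hdu : dist x y ≤ u := (dist_le_two_mul_mstWeight x y).trans huW
      obtain ⟨m, hm1, hm2⟩ := exists_nat_pow_near ((one_le_div hd).2 hdu) hβ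
      have hm3 : m < S * (M + 1) := by
        have h1 := hM x y hxy
        rw [hbdef, ← pow_mul] at h1
        exact (pow_lt_pow_iff_right₀ hβ).1 (hm1.trans_lt h1)
      have hi : m / S ≤ M := by
        have := Nat.div_lt_of_lt_mul hm3
        omega
      let s : Fin S := ⟨m % S, Nat.mod_lt _ hS⟩
      have hRm : R s (M - m / S) = 4 * k * W / β ^ m := by
        have h1 : b ^ M = b ^ (m / S) * b ^ (M - m / S) := by rw [← pow_add]; congr 1; omega
        have h2 : β ^ m = β ^ (m % S) * b ^ (m / S) := by
          rw [hbdef, ← pow_mul, ← pow_add, Nat.mod_add_div]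
        have hbne : b ≠ 0 := hb0.ne'
        have hβne : β ≠ 0 := hβ0.ne'
        simp only [R, s]
        rw [h1, h2]
        field_simp
      have hRu : R s (M - m / S) * (1 / k - 6 / b) = u / β ^ m := by
        rw [hRm, hu]; ring
      have hβm : 0 < β ^ m := by positivity
      have hle : dist x y ≤ R s (M - m / S) * (1 / k - 6 / b) := by
        rw [hRu, le_div_iff₀ hβm, mul_comm]
        exact (le_div_iff₀ hd).1 hm1
      have hlt : R s (M - m / S) * (1 / k - 6 / b) ≤ β * dist x y := by
        rw [hRu, div_le_iff₀ hβm]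
        have := (div_lt_iff₀ hd).1 hm2
        rw [pow_succ] at this
        linarith
      obtain ⟨c, hc⟩ := hF2 s (M - m / S) x y hle
      refine ⟨(s, c), 2 * (M - m / S) + 2, by have := Nat.sub_le M (m / S); omega, ?_, ?_⟩
      · exact chain_eq_of_isConstOn (hR s) hb (hRb s) (hN1 s) (fun a => hF1 s a c) hc
      · have h1 := sum_levelDiam_le (hR s) hb (hRb s) (M - m / S)
        have h2 : R s (M - m / S) * (β * (4 + 30 / b)) ≤ β * (T * dist x y) := by
          calc R s (M - m / S) * (β * (4 + 30 / b))
              ≤ R s (M - m / S) * (T * (1 / k - 6 / b)) :=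
                mul_le_mul_of_nonneg_left hT (hR _ _).le
            _ = T * (R s (M - m / S) * (1 / k - 6 / b)) := by ring
            _ ≤ T * (β * dist x y) := by gcongr
            _ = β * (T * dist x y) := by ring
        have h3 : R s (M - m / S) * (4 + 30 / b) ≤ T * dist x y := by
          refine le_of_mul_le_mul_left ?_ hβ0
          linarith
        have h4 : R s (M - m / S) * (4 + 30 / b) =
          2 * (2 * R s (M - m / S) + 15 * R s (M - m / S) / b) := by ring
        linarith)
    hν hν1 hl (by rw [hJ]; exact hfail)
  refine ⟨D, hD1, fun H hH => ?_⟩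
  obtain ⟨h1, h2⟩ := hD2 H hH
  rw [hJ] at h1
  refine ⟨h1, h2.trans ?_⟩
  have hj : ∀ j : Fin S × Fin P, ∑ p ∈ Finset.range (2 * (M + 1)),
      ((merging (interleave (N j.1) fun a => F j.1 a j.2) p).card * (l : ℝ) ^ 2) *
        levelDiam (R j.1) b (p + 1) ≤ (l : ℝ) ^ 2 * ((36 * (q + 1) * b + 24 * k) * W) := by
    intro j
    have h3 := sum_merging_mul_levelDiam_le (hR j.1) hb (hRb' j.1) (N j.1)
      (fun a => F j.1 a j.2) (hN2 j.1) hq hqM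
    have h4 : R j.1 M ≤ 4 * k * W := by
      have : R j.1 M = 4 * k * W / β ^ (j.1 : ℕ) := by
        simp only [R]
        field_simp
      rw [this]
      exact div_le_self (by positivity) (one_le_pow₀ hβ.le)
    calc _ = (l : ℝ) ^ 2 * ∑ p ∈ Finset.range (2 * (M + 1)),
          ((merging (interleave (N j.1) fun a => F j.1 a j.2) p).card : ℝ) *
            levelDiam (R j.1) b (p + 1) := by
          rw [Finset.mul_sum]
          exact Finset.sum_congr rfl fun p _ => by ring
      _ ≤ (l : ℝ) ^ 2 * ((36 * (q + 1) * b + 24 * k) * W) := by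
          gcongr
          linarith
  refine (Finset.sum_le_card_nsmul _ _ _ fun j _ => hj j).trans_eq ?_
  rw [Finset.card_univ, hJ, nsmul_eq_mul]
  ring

end General

section Parameters

theorem one_sub_pow_le_exp {a : ℝ} (ha : a ≤ 1) (m : ℕ) : (1 - a) ^ m ≤ Real.exp (-(a * m)) := by
  have h1 : 1 - a ≤ Real.exp (-a) := by linarith [Real.add_one_le_exp (-a)]
  calc (1 - a) ^ m ≤ Real.exp (-a) ^ m := pow_le_pow_left₀ (by linarith) h1 m
    _ = Real.exp (-(a * m)) := by rw [← Real.exp_nat_mul]; congr 1; ring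

/-- The number of partitions per scale. -/
theorem exists_partition_count {n x : ℝ} (hn : 1 ≤ n) (hx : 1 ≤ x) :
    ∃ P : ℕ, 1 ≤ P ∧ (1 - x⁻¹) ^ P * n ^ 2 < 1 ∧
      ∀ Q : ℝ, 1 ≤ Q → Real.log n ≤ Q → (P : ℝ) ≤ 3 * x * Q := by
  have hx0 : 0 < x := by linarith
  have hn0 : 0 < n := by linarith
  have hlog : 0 ≤ Real.log n := Real.log_nonneg hn
  refine ⟨⌊2 * x * Real.log n⌋₊ + 1, by omega, ?_, fun Q hQ hnQ => ?_⟩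
  · have h1 := Nat.lt_floor_add_one (2 * x * Real.log n)
    have h2 : 2 * Real.log n < x⁻¹ * ((⌊2 * x * Real.log n⌋₊ + 1 : ℕ) : ℝ) := by
      rw [inv_mul_eq_div, lt_div_iff₀ hx0]
      push_cast
      linarith
    have h3 := one_sub_pow_le_exp (inv_le_one_of_one_le₀ hx) (⌊2 * x * Real.log n⌋₊ + 1)
    have h4 : n ^ 2 = Real.exp (2 * Real.log n) := by
      rw [two_mul, Real.exp_add, Real.exp_log hn0, sq]
    calc _ ≤ Real.exp (-(x⁻¹ * ((⌊2 * x * Real.log n⌋₊ + 1 : ℕ) : ℝ))) * n ^ 2 := by gcongr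
      _ = Real.exp (-(x⁻¹ * ((⌊2 * x * Real.log n⌋₊ + 1 : ℕ) : ℝ)) + 2 * Real.log n) := by
          rw [h4, ← Real.exp_add]
      _ < 1 := by rw [Real.exp_lt_one_iff]; linarith
  · have h1 := Nat.floor_le (show 0 ≤ 2 * x * Real.log n by positivity)
    have h2 : 2 * x * Real.log n ≤ 2 * x * Q := by gcongr
    have h3 : 1 * 1 ≤ x * Q := mul_le_mul hx hQ zero_le_one hx0.le
    push_cast
    linarith

/-- The number of hierarchies per family of partitions: the ratio of consecutive scales of a
hierarchy is a power of `1 + ε / (60 * t)`. -/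
theorem exists_scale_count {ε : ℝ} (h0 : 0 < ε) (h1 : ε < 1 / 2) {t : ℕ} (ht : 1 ≤ t) :
    ∃ S : ℕ, 1080 * t ^ 2 / ε ≤ (1 + ε / (60 * t)) ^ S ∧
      (1 + ε / (60 * t)) ^ S ≤ 2160 * t ^ 2 / ε ∧
      ∀ Q : ℝ, 1 ≤ Q → t ≤ 2 * Q → Real.log (1 / ε) ≤ Q → (S : ℝ) ≤ 3200 * Q ^ 2 / ε := by
  have ht1 : (1 : ℝ) ≤ t := by exact_mod_cast ht
  set δ : ℝ := ε / (60 * t) with hδ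
  have hδ0 : 0 < δ := by positivity
  have hδ1 : δ ≤ 1 := by
    rw [hδ, div_le_one (by positivity)]
    linarith
  have hb0 : 1 ≤ 1080 * (t : ℝ) ^ 2 / ε := by
    rw [one_le_div h0]
    nlinarith
  obtain ⟨m, hm1, hm2⟩ := exists_nat_pow_near hb0 (show 1 < 1 + δ by linarith)
  refine ⟨m + 1, hm2.le, ?_, fun Q hQ htQ hεQ => ?_⟩
  · calc (1 + δ) ^ (m + 1) = (1 + δ) ^ m * (1 + δ) := pow_succ _ _
      _ ≤ 1080 * t ^ 2 / ε * 2 := by gcongr; linarith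
      _ = 2160 * t ^ 2 / ε := by ring
  · have hlog : δ / 2 ≤ Real.log (1 + δ) := by
      have h2 := Real.one_sub_inv_le_log_of_pos (show 0 < 1 + δ by linarith)
      refine le_trans ?_ h2
      rw [show 1 - (1 + δ)⁻¹ = δ / (1 + δ) by field_simp; ring]
      gcongr
      linarith
    have hmlog : m * Real.log (1 + δ) ≤ Real.log (1080 * t ^ 2 / ε) := by
      rw [← Real.log_pow]
      exact Real.log_le_log (by positivity) hm1
    have hblog : Real.log (1080 * t ^ 2 / ε) ≤ 13 * Q := by
      have h3 : 1080 * (t : ℝ) ^ 2 / ε = 1080 * ((t : ℝ) * t * (1 / ε)) := by ring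
      rw [h3, Real.log_mul (by norm_num) (by positivity), Real.log_mul (by positivity)
        (by positivity), Real.log_mul (by positivity) (by positivity)]
      have h4 : Real.log 1080 ≤ 8 := by
        have : Real.log 1080 ≤ Real.log (2 ^ 11) := Real.log_le_log (by norm_num) (by norm_num)
        rw [Real.log_pow] at this
        have := Real.log_two_lt_d9
        push_cast at *
        linarith
      have h5 := Real.log_le_sub_one_of_pos (show (0 : ℝ) < t by linarith)
      linarith
    have hm : (m : ℝ) * (δ / 2) ≤ 13 * Q := by
      have : (m : ℝ) * (δ / 2) ≤ m * Real.log (1 + δ) := by gcongr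
      linarith
    have h6 : (m : ℝ) * ε ≤ 1560 * t * Q := by
      have : (m : ℝ) * (δ / 2) = m * ε / (120 * t) := by rw [hδ]; field_simp; ring
      rw [this, div_le_iff₀ (by positivity)] at hm
      linarith
    have h7 : 1560 * t * Q ≤ 1560 * (2 * Q) * Q := by gcongr
    rw [le_div_iff₀ h0]
    push_cast
    nlinarith

/-- The number of samples per cluster. -/
theorem exists_sample_count {n ν τ : ℝ} (hn : 1 ≤ n) (hν : 0 < ν) (hν1 : ν ≤ 1) (hτ : 1 ≤ τ) :
    ∃ l : ℕ, 1 ≤ l ∧ n ^ 3 * τ * (1 - ν / (4 * τ)) ^ l ≤ ν / 2 ∧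
      ∀ Q : ℝ, 1 ≤ Q → Real.log n ≤ Q → Real.log (1 / ν) ≤ Q → Real.log τ ≤ 15 * Q →
        (l : ℝ) ≤ 81 * τ * Q / ν := by
  set y : ℝ := 2 * τ * n ^ 3 / ν with hy
  have hy1 : 2 ≤ y := by
    rw [hy, le_div_iff₀ hν]
    have h1 : 1 ≤ n ^ 3 := one_le_pow₀ hn
    have h2 : 1 * 1 ≤ τ * n ^ 3 := mul_le_mul hτ h1 zero_le_one (by linarith)
    linarith
  have hy0 : 0 < y := by linarith
  have hlog : 0 < Real.log y := Real.log_pos (by linarith)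
  have hτ0 : 0 < τ := by linarith
  have hn0 : 0 < n := by linarith
  refine ⟨⌈4 * τ / ν * Real.log y⌉₊, ?_, ?_, fun Q hQ h1 h2 h3 => ?_⟩
  · exact Nat.one_le_ceil_iff.2 (by positivity)
  · have h1 := Nat.le_ceil (4 * τ / ν * Real.log y)
    have h2 : Real.log y ≤ ν / (4 * τ) * (⌈4 * τ / ν * Real.log y⌉₊ : ℝ) := by
      calc Real.log y = ν / (4 * τ) * (4 * τ / ν * Real.log y) := by field_simp
        _ ≤ _ := by gcongr
    have h3 := one_sub_pow_le_exp (a := ν / (4 * τ)) (by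
      rw [div_le_one (by positivity)]; linarith) ⌈4 * τ / ν * Real.log y⌉₊
    calc n ^ 3 * τ * (1 - ν / (4 * τ)) ^ ⌈4 * τ / ν * Real.log y⌉₊
        ≤ n ^ 3 * τ * Real.exp (-(Real.log y)) := by
          gcongr
          refine h3.trans (Real.exp_le_exp.2 ?_)
          linarith
      _ = ν / 2 := by
          rw [Real.exp_neg, Real.exp_log hy0, hy]
          field_simp
  · have h4 : Real.log y ≤ 20 * Q := by
      have h5 : y = 2 * (τ * (n ^ 3 * (1 / ν))) := by rw [hy]; ring
      rw [h5, Real.log_mul (by norm_num) (by positivity), Real.log_mul (by positivity)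
        (by positivity), Real.log_mul (by positivity) (by positivity), Real.log_pow]
      have := Real.log_two_lt_d9
      push_cast
      linarith
    have h5 := (Nat.ceil_lt_add_one (show 0 ≤ 4 * τ / ν * Real.log y by positivity)).le
    have h6 : 4 * τ / ν * Real.log y ≤ 4 * τ / ν * (20 * Q) := by gcongr
    have h7 : 1 ≤ τ * Q / ν := by
      rw [one_le_div hν]
      nlinarith
    calc (⌈4 * τ / ν * Real.log y⌉₊ : ℝ) ≤ 4 * τ / ν * (20 * Q) + τ * Q / ν := by linarith
      _ = 81 * τ * Q / ν := by ring

/-- The stretch of the spanner, for hierarchies whose scales grow by the factor `b`. -/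
theorem stretch_le {ε b : ℝ} (h0 : 0 < ε) (h1 : ε < 1 / 2) {t : ℕ} (ht : 1 ≤ t)
    (hb : 1080 * t ^ 2 / ε ≤ b) :
    (1 + ε / (60 * t)) * (4 + 30 / b) ≤ (12 * t + ε) * (1 / (3 * t : ℕ) - 6 / b) := by
  have ht1 : (1 : ℝ) ≤ t := by exact_mod_cast ht
  have ht0 : (0 : ℝ) < t := by linarith
  set δ : ℝ := ε / (60 * t) with hδ
  have hδ0 : 0 < δ := by positivity
  have hε : ε = 60 * t * δ := by rw [hδ]; field_simp
  have hδ1 : δ ≤ 1 / 120 := by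
    rw [hδ, div_le_iff₀ (by positivity)]
    linarith
  have hbpos : 0 < 1080 * (t : ℝ) ^ 2 / ε := by positivity
  have hinv : 1 / b ≤ δ / (18 * t) := by
    calc 1 / b ≤ 1 / (1080 * (t : ℝ) ^ 2 / ε) := one_div_le_one_div_of_le hbpos hb
      _ = δ / (18 * t) := by rw [hδ]; field_simp; norm_num
  have h30 : 30 / b ≤ 2 * δ := by
    have h2 : δ / (18 * t) ≤ δ / 18 := by
      gcongr
      linarith
    have h3 : 30 / b = 30 * (1 / b) := by ring
    linarith
  have h6 : (1 - δ) / (3 * t) ≤ 1 / (3 * t : ℕ) - 6 / b := by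
    have h2 : (1 - δ) / (3 * t : ℝ) = 1 / (3 * t) - 6 * (δ / (18 * t)) := by field_simp; ring
    have h3 : 6 / b = 6 * (1 / b) := by ring
    push_cast
    linarith
  calc (1 + δ) * (4 + 30 / b) ≤ (1 + δ) * (4 + 2 * δ) := by gcongr
    _ ≤ (4 + 20 * δ) * (1 - δ) := by nlinarith
    _ = (12 * t + ε) * ((1 - δ) / (3 * t)) := by
        rw [hε]
        field_simp
        ring
    _ ≤ (12 * t + ε) * (1 / (3 * t : ℕ) - 6 / b) := by gcongr

end Parameters

section Main

theorem rpow_one_div_le {n : ℕ} (hn : 2 ≤ n) {t : ℕ} (ht : 1 ≤ t) :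
    (n : ℝ) ^ (1 / (min t (Nat.clog 2 n) : ℕ) : ℝ) ≤ 2 * (n : ℝ) ^ (1 / (t : ℝ)) := by
  have hn1 : (1 : ℝ) ≤ n := by exact_mod_cast (by omega : 1 ≤ n)
  have hge : 1 ≤ (n : ℝ) ^ (1 / (t : ℝ)) := Real.one_le_rpow hn1 (by positivity)
  rcases le_total t (Nat.clog 2 n) with h | h
  · rw [min_eq_left h]
    linarith
  · rw [min_eq_right h]
    have hc : 0 < Nat.clog 2 n := Nat.clog_pos (by norm_num) hn
    have h1 : (n : ℝ) ≤ (2 : ℝ) ^ (Nat.clog 2 n) := by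
      exact_mod_cast Nat.le_pow_clog (by norm_num) n
    have h2 : (n : ℝ) ^ (1 / (Nat.clog 2 n : ℕ) : ℝ) ≤ 2 := by
      calc (n : ℝ) ^ (1 / (Nat.clog 2 n : ℕ) : ℝ)
          ≤ ((2 : ℝ) ^ (Nat.clog 2 n)) ^ (1 / (Nat.clog 2 n : ℕ) : ℝ) :=
            Real.rpow_le_rpow (by linarith) h1 (by positivity)
        _ = 2 := by
            rw [one_div]
            exact Real.pow_rpow_inv_natCast (by norm_num) hc.ne'
    linarith

theorem clog_le {n : ℕ} (hn : 2 ≤ n) : (Nat.clog 2 n : ℝ) ≤ Real.logb 2 n + 1 := by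
  have hc : 0 < Nat.clog 2 n := Nat.clog_pos (by norm_num) hn
  have h1 : 2 ^ (Nat.clog 2 n - 1) < n := by
    have := Nat.pow_pred_clog_lt_self (b := 2) (by norm_num) (show 1 < n by omega)
    simpa using this
  have h2 : ((Nat.clog 2 n - 1 : ℕ) : ℝ) ≤ Real.logb 2 n := by
    rw [Real.le_logb_iff_rpow_le (by norm_num) (by exact_mod_cast (by omega : 0 < n)),
      Real.rpow_natCast]
    exact_mod_cast h1.le
  rw [Nat.cast_sub hc] at h2
  push_cast at h2
  linarith

theorem log_le_logb_two {x : ℝ} (hx : 1 ≤ x) : Real.log x ≤ Real.logb 2 x := by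
  rw [Real.logb, le_div_iff₀ (Real.log_pos (by norm_num))]
  have h1 := Real.log_two_lt_d9
  have h2 := Real.log_nonneg hx
  nlinarith

/-- The spanner for two or more points, with all logarithmic factors bounded by powers of a common
quantity `Q`. -/
theorem exists_light_spanner_of_logs {X : Type*} [MetricSpace X] [Fintype X] [Nontrivial X]
    {ν ε : ℝ} {t : ℕ} (hν : 0 < ν) (hν1 : ν < 1 / 6) (hε : 0 < ε) (hε1 : ε < 1 / 2) (ht : 1 ≤ t) :
    ∃ D : PMF (WGraph X), IsObliviousReliableSpanner ν (12 * (t : ℝ) + ε) D ∧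
      ∀ H ∈ D.support, ∀ Q : ℝ, 1 ≤ Q → Real.logb 2 (Fintype.card X) ≤ Q →
        Real.log (1 / ε) ≤ Q → Real.log (1 / ν) ≤ Q →
        (H.size : ℝ) ≤ 10 ^ 24 * ((Fintype.card X : ℝ) * (Fintype.card X : ℝ) ^ (1 / (t : ℝ)) *
          (ν ^ 2)⁻¹ * (ε ^ 3)⁻¹) * Q ^ 14 ∧
        (H.totalWeight : ℝ) ≤ 10 ^ 24 * ((Fintype.card X : ℝ) ^ (1 / (t : ℝ)) *
          ((ν ^ 2)⁻¹ * (ε ^ 4)⁻¹)) * Q ^ 14 * mstWeight X := by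
  set n := Fintype.card X with hn
  have hn2 : 2 ≤ n := Fintype.one_lt_card
  have hn1 : (1 : ℝ) ≤ n := by exact_mod_cast (by omega : 1 ≤ n)
  have hn0 : (0 : ℝ) < n := by linarith
  set q := Nat.clog 2 n with hq
  have hq1 : 1 ≤ q := Nat.clog_pos (by norm_num) hn2
  set t₀ := min t q with ht₀
  have ht₀1 : 1 ≤ t₀ := le_min ht hq1
  have ht₀R : (1 : ℝ) ≤ t₀ := by exact_mod_cast ht₀1
  set x : ℝ := (n : ℝ) ^ (((3 * t₀ : ℕ) : ℝ)⁻¹) with hx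
  have hx1 : 1 ≤ x := Real.one_le_rpow hn1 (by positivity)
  have hx0 : 0 < x := by linarith
  have hxn : x ≤ n := by
    calc x ≤ (n : ℝ) ^ (1 : ℝ) := Real.rpow_le_rpow_of_exponent_le hn1
          (inv_le_one_of_one_le₀ (by exact_mod_cast (by omega : 1 ≤ 3 * t₀)))
      _ = n := Real.rpow_one _
  have hxk : x ^ (3 * t₀) = n := Real.rpow_inv_natCast_pow hn0.le (by omega)
  have hx3 : x ^ 3 ≤ 2 * (n : ℝ) ^ (1 / (t : ℝ)) := by
    refine le_trans (le_of_eq ?_) (rpow_one_div_le hn2 ht)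
    change x ^ 3 = (n : ℝ) ^ (1 / (t₀ : ℝ))
    rw [hx, ← Real.rpow_natCast, ← Real.rpow_mul hn0.le]
    congr 1
    push_cast
    field_simp
  obtain ⟨P, hP1, hP, hPQ⟩ := exists_partition_count hn1 hx1
  obtain ⟨S, hS1, hS2, hSQ⟩ := exists_scale_count hε hε1 ht₀1
  have hSpos : 1 ≤ S := by
    rcases Nat.eq_zero_or_pos S with h | h
    · rw [h, pow_zero, div_le_one hε] at hS1
      nlinarith
    · exact h
  have hτ1 : (1 : ℝ) ≤ (S * P : ℕ) := by exact_mod_cast Nat.mul_pos hSpos hP1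
  obtain ⟨l, hl1, hl, hlQ⟩ := exists_sample_count hn1 hν (by linarith) hτ1
  have hb1080 : 1080 * (t₀ : ℝ) ≤ (1 + ε / (60 * t₀)) ^ S := by
    refine le_trans ?_ hS1
    rw [le_div_iff₀ hε]
    nlinarith
  obtain ⟨D, hD1, hD2⟩ := exists_light_spanner (X := X) (k := 3 * t₀) (by omega) (p := x⁻¹)
    (β := 1 + ε / (60 * t₀)) (T := 12 * t₀ + ε) (ν := ν) (S := S) (P := P) (l := l) (q := q)
    (by positivity) (inv_le_one_of_one_le₀ hx1)
    (by rw [inv_pow, hxk, inv_mul_cancel₀ hn0.ne']) hP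
    (by have : 0 < ε / (60 * t₀) := by positivity
        linarith)
    (by linarith) (by push_cast; linarith) (by positivity) (stretch_le hε hε1 ht₀1 hS1) hν
    (by linarith) hl1 hl (Nat.le_pow_clog (by norm_num) n)
  refine ⟨D, ⟨hD1.1, fun B => ?_⟩, fun H hH Q hQ1 hQn hQε hQν => ?_⟩
  · obtain ⟨Bplus, h1, h2⟩ := hD1.2 B
    refine ⟨Bplus, fun H hH => ⟨(h1 H hH).1, fun x y hx hy => ((h1 H hH).2 x y hx hy).trans ?_⟩, h2⟩
    gcongr
    exact min_le_left _ _
  obtain ⟨hsize, hweight⟩ := hD2 H hH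
  have hQ0 : 0 < Q := by linarith
  have hlogn : Real.log n ≤ Q := (log_le_logb_two hn1).trans hQn
  have hq2 : (q : ℝ) ≤ 2 * Q := (clog_le hn2).trans (by linarith)
  have ht₀Q : (t₀ : ℝ) ≤ 2 * Q := (Nat.cast_le.2 (min_le_right _ _)).trans hq2
  have hSP : ((S * P : ℕ) : ℝ) ≤ 10000 * x * Q ^ 3 / ε := by
    push_cast
    calc (S : ℝ) * P ≤ 3200 * Q ^ 2 / ε * (3 * x * Q) :=
          mul_le_mul (hSQ Q hQ1 ht₀Q hQε) (hPQ Q hQ1 hlogn) (by positivity) (by positivity)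
      _ = 9600 * (x * Q ^ 3 / ε) := by ring
      _ ≤ 10000 * (x * Q ^ 3 / ε) := by gcongr; norm_num
      _ = 10000 * x * Q ^ 3 / ε := by ring
  have hlogτ : Real.log (S * P : ℕ) ≤ 15 * Q := by
    refine (Real.log_le_log (by linarith) hSP).trans ?_
    rw [show 10000 * x * Q ^ 3 / ε = 10000 * (x * (Q ^ 3 * (1 / ε))) by ring,
      Real.log_mul (by norm_num) (by positivity), Real.log_mul (by positivity) (by positivity),
      Real.log_mul (by positivity) (by positivity), Real.log_pow Q]
    have h1 : Real.log (10000) ≤ 10 := by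
      have : Real.log 10000 ≤ Real.log (2 ^ 14) :=
        Real.log_le_log (by norm_num) (by norm_num)
      rw [Real.log_pow 2] at this
      have := Real.log_two_lt_d9
      push_cast at *
      linarith
    have h2 : Real.log x ≤ Q := (Real.log_le_log hx0 hxn).trans hlogn
    have h3 := Real.log_le_sub_one_of_pos hQ0
    push_cast
    linarith
  have hl2 := hlQ Q hQ1 hlogn hQν hlogτ
  have hcore : ((S * P : ℕ) : ℝ) * (l : ℝ) ^ 2 ≤
      10 ^ 17 * (n : ℝ) ^ (1 / (t : ℝ)) * (ν ^ 2)⁻¹ * (ε ^ 3)⁻¹ * Q ^ 11 := by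
    set τ : ℝ := ((S * P : ℕ) : ℝ) with hτ
    calc τ * (l : ℝ) ^ 2 ≤ τ * (81 * τ * Q / ν) ^ 2 := by gcongr
      _ = 6561 * τ ^ 3 * Q ^ 2 * (ν ^ 2)⁻¹ := by ring
      _ ≤ 6561 * (10000 * x * Q ^ 3 / ε) ^ 3 * Q ^ 2 * (ν ^ 2)⁻¹ := by gcongr
      _ = 6561 * 10 ^ 12 * x ^ 3 * (ν ^ 2)⁻¹ * (ε ^ 3)⁻¹ * Q ^ 11 := by ring
      _ ≤ 6561 * 10 ^ 12 * (2 * (n : ℝ) ^ (1 / (t : ℝ))) * (ν ^ 2)⁻¹ * (ε ^ 3)⁻¹ * Q ^ 11 := by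
          gcongr
      _ = (6561 * 10 ^ 12 * 2) * ((n : ℝ) ^ (1 / (t : ℝ)) * (ν ^ 2)⁻¹ * (ε ^ 3)⁻¹ * Q ^ 11) := by
          ring
      _ ≤ 10 ^ 17 * ((n : ℝ) ^ (1 / (t : ℝ)) * (ν ^ 2)⁻¹ * (ε ^ 3)⁻¹ * Q ^ 11) := by
          gcongr
          norm_num
      _ = _ := by ring
  constructor
  · calc (H.size : ℝ) ≤ ((S * P * (l ^ 2 * (2 * n)) : ℕ) : ℝ) := by exact_mod_cast hsize
      _ = ((S * P : ℕ) : ℝ) * (l : ℝ) ^ 2 * (2 * n) := by push_cast; ring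
      _ ≤ 10 ^ 17 * (n : ℝ) ^ (1 / (t : ℝ)) * (ν ^ 2)⁻¹ * (ε ^ 3)⁻¹ * Q ^ 11 * (2 * n) := by
          gcongr
      _ = 2 * 10 ^ 17 * (n * (n : ℝ) ^ (1 / (t : ℝ)) * (ν ^ 2)⁻¹ * (ε ^ 3)⁻¹) * Q ^ 11 := by ring
      _ ≤ 10 ^ 24 * (n * (n : ℝ) ^ (1 / (t : ℝ)) * (ν ^ 2)⁻¹ * (ε ^ 3)⁻¹) * Q ^ 14 := by
          have h2 : Q ^ 11 ≤ Q ^ 14 := pow_le_pow_right₀ hQ1 (by norm_num)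
          gcongr
          norm_num
  · have hQε0 : Q ≤ Q ^ 3 / ε := by
      rw [le_div_iff₀ hε]
      have h2 : 1 ≤ Q ^ 2 := one_le_pow₀ hQ1
      nlinarith
    have hb : 36 * ((q : ℝ) + 1) * (1 + ε / (60 * t₀)) ^ S + 24 * (3 * t₀ : ℕ) ≤
        10 ^ 6 * (Q ^ 3 / ε) := by
      calc 36 * ((q : ℝ) + 1) * (1 + ε / (60 * t₀)) ^ S + 24 * (3 * t₀ : ℕ)
          ≤ 36 * (3 * Q) * (2160 * (2 * Q) ^ 2 / ε) + 72 * (2 * Q) := by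
            refine add_le_add (mul_le_mul ?_ (hS2.trans ?_) (by positivity) (by positivity)) ?_
            · linarith
            · gcongr
            · push_cast; linarith
        _ = 933120 * (Q ^ 3 / ε) + 144 * Q := by ring
        _ ≤ 933120 * (Q ^ 3 / ε) + 144 * (Q ^ 3 / ε) := by gcongr
        _ ≤ 10 ^ 6 * (Q ^ 3 / ε) := by
            have : 0 < Q ^ 3 / ε := by positivity
            linarith
    calc (H.totalWeight : ℝ) ≤ _ := hweight
      _ ≤ 10 ^ 17 * (n : ℝ) ^ (1 / (t : ℝ)) * (ν ^ 2)⁻¹ * (ε ^ 3)⁻¹ * Q ^ 11 *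
          (10 ^ 6 * (Q ^ 3 / ε)) * mstWeight X := by gcongr
      _ = 10 ^ 23 * ((n : ℝ) ^ (1 / (t : ℝ)) * ((ν ^ 2)⁻¹ * (ε ^ 4)⁻¹)) * Q ^ 14 * mstWeight X := by
          ring
      _ ≤ 10 ^ 24 * ((n : ℝ) ^ (1 / (t : ℝ)) * ((ν ^ 2)⁻¹ * (ε ^ 4)⁻¹)) * Q ^ 14 * mstWeight X := by
          gcongr <;> norm_num

/-- On at most one point the edgeless graph is a spanner. -/
theorem isObliviousReliableSpanner_pure_bot {X : Type*} [MetricSpace X] [Fintype X]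
    [Subsingleton X] {ν t : ℝ} (hν : 0 ≤ ν) :
    IsObliviousReliableSpanner ν t (PMF.pure (WGraph.ofMetric (⊥ : SimpleGraph X))) := by
  refine ⟨fun H hH => ?_, fun B => ⟨fun _ => B, fun H _ => ⟨subset_rfl, fun x y _ _ => ?_⟩, ?_⟩⟩
  · rw [PMF.support_pure, Set.mem_singleton_iff] at hH
    subst hH
    exact WGraph.ofMetric_dominates _
  · rw [Subsingleton.elim x y, WGraph.dist_self]
    exact zero_le
  · rw [ENNReal.tsum_mul_right, PMF.tsum_coe]
    gcongr
    rw [ENNReal.one_le_ofReal]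
    linarith

end Main

end ReliableSpanner

theorem mainTheorem3 :
    ∃ (C : ℝ) (c : ℕ), ∀ (X : Type*) [MetricSpace X] [Fintype X] (ν ε : ℝ) (t n : ℕ),
      0 < ν → ν < 1 / 6 → 0 < ε → ε < 1 / 2 → 1 ≤ t → n = Fintype.card X →
      ∃ D : PMF (ReliableSpanner.WGraph X),
        ReliableSpanner.IsObliviousReliableSpanner ν (12 * (t : ℝ) + ε) D ∧
        ReliableSpanner.HasSize D
          (ReliableSpanner.softO C c
            ((n : ℝ) ^ (1 + 1 / (t : ℝ)) * (ν ^ 2)⁻¹ * (ε ^ 3)⁻¹)) ∧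
        ReliableSpanner.HasLightness D
          ((n : ℝ) ^ (1 / (t : ℝ)) * ReliableSpanner.softO C c ((ν ^ 2)⁻¹ * (ε ^ 4)⁻¹) *
            Real.logb 2 (n : ℝ) ^ c) := by
  refine ⟨10 ^ 24, 14, ?_⟩
  intro X _ _ ν ε t n hν hν1 hε hε1 ht hn
  have hνinv : 6 ≤ 1 / ν := by rw [le_div_iff₀ hν]; linarith
  have hεinv : 2 ≤ 1 / ε := by rw [le_div_iff₀ hε]; linarith
  have hν2 : 1 / ν ≤ (ν ^ 2)⁻¹ := by
    rw [← inv_pow, ← one_div]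
    exact le_self_pow₀ (by linarith) (by norm_num)
  have hεpow : ∀ m : ℕ, m ≠ 0 → 1 / ε ≤ (ε ^ m)⁻¹ := by
    intro m hm
    rw [← inv_pow, ← one_div]
    exact le_self_pow₀ (by linarith) hm
  have hlogb : ∀ {u v : ℝ}, 1 ≤ u → u ≤ v → Real.log u ≤ Real.logb 2 v := fun {u v} hu huv =>
    (ReliableSpanner.log_le_logb_two hu).trans
      (Real.logb_le_logb_of_le (by norm_num) (by linarith) huv)
  have hlogb1 : ∀ {v : ℝ}, 2 ≤ v → 1 ≤ Real.logb 2 v := fun {v} hv => by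
    rw [Real.le_logb_iff_rpow_le (by norm_num) (by linarith), Real.rpow_one]
    exact hv
  rcases subsingleton_or_nontrivial X with hX | hX
  · refine ⟨PMF.pure (ReliableSpanner.WGraph.ofMetric ⊥),
      ReliableSpanner.isObliviousReliableSpanner_pure_bot hν.le, ?_, ?_⟩
    · intro H hH
      rw [PMF.support_pure, Set.mem_singleton_iff] at hH
      subst hH
      have h0 : (ReliableSpanner.WGraph.ofMetric (⊥ : SimpleGraph X)).size = 0 := by
        rw [ReliableSpanner.WGraph.size, Finset.card_eq_zero]
        exact Finset.eq_empty_of_forall_notMem fun e he => by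
          classical
          rw [SimpleGraph.mem_edgeFinset] at he
          simp [ReliableSpanner.WGraph.ofMetric] at he
      rw [h0, Nat.cast_zero, ReliableSpanner.softO]
      exact mul_nonneg (by positivity) (Even.pow_nonneg (by decide) _)
    · intro H hH
      rw [PMF.support_pure, Set.mem_singleton_iff] at hH
      subst hH
      have h0 : (ReliableSpanner.WGraph.ofMetric (⊥ : SimpleGraph X)).totalWeight = 0 := by
        rw [ReliableSpanner.WGraph.totalWeight]
        exact Finset.sum_eq_zero fun e he => by
          classical
          rw [SimpleGraph.mem_edgeFinset] at he
          simp [ReliableSpanner.WGraph.ofMetric] at he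
      rw [h0, NNReal.coe_zero, ReliableSpanner.softO]
      have h1 : ∀ u : ℝ, 0 ≤ Real.logb 2 u ^ 14 := fun u => Even.pow_nonneg (by decide) _
      have h2 := h1 (n : ℝ)
      have h3 := h1 ((ν ^ 2)⁻¹ * (ε ^ 4)⁻¹)
      positivity
  · obtain ⟨D, hD1, hD2⟩ := ReliableSpanner.exists_light_spanner_of_logs (X := X) hν hν1 hε hε1 ht
    rw [← hn] at hD2
    have hn2 : (2 : ℝ) ≤ n := by
      rw [hn]
      exact_mod_cast Fintype.one_lt_card (α := X)
    have hn0 : (0 : ℝ) < n := by linarith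
    refine ⟨D, hD1, fun H hH => ?_, fun H hH => ?_⟩
    · set s : ℝ := (n : ℝ) ^ (1 + 1 / (t : ℝ)) * (ν ^ 2)⁻¹ * (ε ^ 3)⁻¹ with hs
      have hsplit : (n : ℝ) ^ (1 + 1 / (t : ℝ)) = n * (n : ℝ) ^ (1 / (t : ℝ)) := by
        rw [Real.rpow_add hn0, Real.rpow_one]
      have hnle : (n : ℝ) ≤ (n : ℝ) ^ (1 + 1 / (t : ℝ)) := by
        rw [hsplit]
        exact le_mul_of_one_le_right hn0.le (Real.one_le_rpow (by linarith) (by positivity))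
      have hε3 := hεpow 3 (by norm_num)
      have hA : (1 : ℝ) ≤ (n : ℝ) ^ (1 + 1 / (t : ℝ)) := by linarith
      have hAB : (n : ℝ) ^ (1 + 1 / (t : ℝ)) ≤ (n : ℝ) ^ (1 + 1 / (t : ℝ)) * (ν ^ 2)⁻¹ :=
        le_mul_of_one_le_right (by linarith) (by linarith)
      have hns : (n : ℝ) ≤ s :=
        hnle.trans (hAB.trans (le_mul_of_one_le_right (by linarith) (by linarith)))
      have hεs : 1 / ε ≤ s := hε3.trans (le_mul_of_one_le_left (by linarith) (by linarith))
      have hνs : 1 / ν ≤ s := by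
        refine hν2.trans ((le_mul_of_one_le_left (by linarith) hA).trans ?_)
        exact le_mul_of_one_le_right (by linarith) (by linarith)
      have h := (hD2 H hH (Real.logb 2 s) (hlogb1 (by linarith))
        (Real.logb_le_logb_of_le (by norm_num) hn0 hns) (hlogb (by linarith) hεs)
        (hlogb (by linarith) hνs)).1
      rw [← hsplit, ← hs] at h
      exact h
    · set r : ℝ := (ν ^ 2)⁻¹ * (ε ^ 4)⁻¹ with hr
      have hε4 := hεpow 4 (by norm_num)
      have hεr : 1 / ε ≤ r := hε4.trans (le_mul_of_one_le_left (by linarith) (by linarith))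
      have hνr : 1 / ν ≤ r := hν2.trans (le_mul_of_one_le_right (by linarith) (by linarith))
      have hr1 : 1 ≤ Real.logb 2 r := hlogb1 (by linarith)
      have hln1 : 1 ≤ Real.logb 2 (n : ℝ) := hlogb1 hn2
      have hrQ : Real.logb 2 r ≤ Real.logb 2 r * Real.logb 2 n :=
        le_mul_of_one_le_right (by linarith) hln1
      have h := (hD2 H hH (Real.logb 2 r * Real.logb 2 n) (hr1.trans hrQ)
        (le_mul_of_one_le_left (by linarith) hr1) ((hlogb (by linarith) hεr).trans hrQ)
        ((hlogb (by linarith) hνr).trans hrQ)).2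
      refine h.trans_eq ?_
      rw [ReliableSpanner.softO]
      ring
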